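/- Let $i\mathsf{RCA}_0^\omega$ be the following theory in the language of all finite types ($0$ is the type of natural numbers, $\rho\to\tau$ the type of functions, $1=0\to0$). Its terms are built by application from variables, $0$, the successor $S$, the combinators $\Pi,\Sigma$ of all types and the primitive recursor $R$ of type $0$; its only prime formulas are equations of type $0$ and $\bot$, and equality of higher type is defined pointwise. It uses intuitionistic predicate logic with the equality axioms for type $0$, extensionality $x=_\rho y\to zx=_\tau zy$ at all types, $Sx\neq0$, $Sx=Sy\to x=y$, the defining equations $\Pi xy=x$, $\Sigma xyz=xz(yz)$, $R0yz=y$, $R(Sx)yz=z(Rxyz)x$, induction for quantifier-free formulas, and $\mathsf{QF\text{-}AC}^{1,0}$: $\forall x^1\exists n^0A(x,n)\to\exists\Phi^{1\to0}\forall x\,A(x,\Phi(x))$ for quantifier-free $A$ (parameters allowed in both schemes). For problems $\mathsf P:\forall x(p_1(x)\to\exists y\,p_2(x,y))$ and $\mathsf Q:\forall u(q_1(u)\to\exists v\,q_2(u,v))$, let $\mathsf Q\le_W\mathsf P$ be the formula $$\exists\Phi\,\exists\Psi\,\forall u\,\forall y\,\bigl(q_1(u)\to(p_1(\Phi(u))\wedge(p_2(\Phi(u),y)\to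 q_2(u,\Psi(y))))\bigr),$$ where $\Phi$ maps inputs of $\mathsf Q$ to inputs of $\mathsf P$ and $\Psi$ maps outputs of $\mathsf P$ to outputs of $\mathsf Q$, and let $\mathsf P\equiv_W\mathsf Q$ be $\mathsf P\le_W\mathsf Q\wedge\mathsf Q\le_W\mathsf P$. $\mathsf{LPO}$ is the total problem with inputs $p:\mathbb N\to\mathbb N$ and outputs $n\in\mathbb N$ in which $n$ is a solution for $p$ when $$(n=0\to\forall i\,(p(i)>0))\wedge(n>0\to(p(n-1)=0\wedge\forall t\,(t<n-1\to p(t)>0))).$$ A function $e:\mathbb N\to\mathbb N$ codes the graph $G$ on $\mathbb N$ in which, for $a<b$, $(a,b)$ is an edge iff $e(b(b-1)/2+a)\ne0$. Write $G_m$ for the subgraph induced on $\{0,\dots,m\}$. It has a $k$-coloring if there is a function $f$ with $f(a)<k$ for all $a\le m$ and $f(a)\neq f(b)$ for all edges $(a,b)$ of $G$ with $a<b\le m$. Then there is a closed term $c$ such that $i\mathsf{RCA}_0^\omega$ proves that, for all $k,G,m$, either $G_m$ has a $k$-coloring and $c(k,G,m)=1$, or $G_m$ has no $k$-coloring and $c(k,G,m)=0$.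 For any such $c$, let $\mathsf{LG}k$ be the total problem with inputs $G$ (coded as above) and outputs $n\in\mathbb N$ in which $n$ is a solution for $G$ when $$(n=0\to\forall m\,(c(k,G,m)=1))\wedge(n>0\to(c(k,G,n)=0\wedge\forall t\,(t<n\to c(k,G,t)=1))).$$ Then $i\mathsf{RCA}_0^\omega$ proves $$\forall k\,\forall j\,\bigl(1\le k\to k\le j\to(\mathsf{LPO}\equiv_W\mathsf{LG}k\ \wedge\ \mathsf{LG}k\equiv_W\mathsf{LG}j)\bigr).$$ In particular, $i\mathsf{RCA}_0^\omega$ proves $\mathsf{LG}2\equiv_W\mathsf{LG}3$. -/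

import Mathlib

/-!
The system `iRCA₀^ω`: intuitionistic arithmetic in all finite types with full extensionality,
the type-`0` primitive recursor, quantifier-free induction and the choice scheme `QF-AC^{1,0}`.
It is given by its syntax (well-typed terms and formulas with de Bruijn variables) and by
natural deduction. Formalized Weihrauch reducibility is a formula of its language.
-/

namespace IRCA

/-- Finite types: `0` (natural numbers) and function types. -/
inductive Ty : Type
  | nat : Ty
  | arr : Ty → Ty → Ty

infixr:60 " ⇒ " => Ty.arr

/-- The type `1 = 0 ⇒ 0`. -/
abbrev Ty.one : Ty := Ty.nat ⇒ Ty.nat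

/-- A context lists the types of the variables that may occur free; variable `0` is its head. -/
abbrev Ctx : Type := List Ty

/-- De Bruijn variables of a given type in a context. -/
inductive Var : Ctx → Ty → Type
  | z {Γ : Ctx} {σ : Ty} : Var (σ :: Γ) σ
  | s {Γ : Ctx} {σ τ : Ty} : Var Γ τ → Var (σ :: Γ) τ

/-- Terms: variables, `0`, successor, the combinators `Π` (here `K`) and `Σ` (here `S`),
the primitive recursor `R` of type `0`, and application. -/
inductive Tm (Γ : Ctx) : Ty → Type
  | var {τ : Ty} : Var Γ τ → Tm Γ τ
  | zero : Tm Γ Ty.nat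
  | succ : Tm Γ (Ty.nat ⇒ Ty.nat)
  | K (ρ τ : Ty) : Tm Γ (ρ ⇒ τ ⇒ ρ)
  | S (δ ρ τ : Ty) : Tm Γ ((δ ⇒ ρ ⇒ τ) ⇒ (δ ⇒ ρ) ⇒ δ ⇒ τ)
  | R : Tm Γ (Ty.nat ⇒ Ty.nat ⇒ (Ty.nat ⇒ Ty.nat ⇒ Ty.nat) ⇒ Ty.nat)
  | app {ρ τ : Ty} : Tm Γ (ρ ⇒ τ) → Tm Γ ρ → Tm Γ τ

infixl:75 " ⬝ " => Tm.app

/-- Formulas with free variables in a context. The only prime formulas are equations of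
type `0` and `⊥`. -/
inductive Fm : Ctx → Type
  | eq {Γ : Ctx} : Tm Γ Ty.nat → Tm Γ Ty.nat → Fm Γ
  | bot {Γ : Ctx} : Fm Γ
  | and {Γ : Ctx} : Fm Γ → Fm Γ → Fm Γ
  | or {Γ : Ctx} : Fm Γ → Fm Γ → Fm Γ
  | imp {Γ : Ctx} : Fm Γ → Fm Γ → Fm Γ
  | all {Γ : Ctx} (σ : Ty) : Fm (σ :: Γ) → Fm Γ
  | ex {Γ : Ctx} (σ : Ty) : Fm (σ :: Γ) → Fm Γ

infix:50 " ≐ " => Fm.eq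
infixr:40 " ⋏ " => Fm.and
infixr:37 " ⋎ " => Fm.or
infixr:35 " ⟶' " => Fm.imp

/-- Negation. -/
def Fm.neg {Γ : Ctx} (A : Fm Γ) : Fm Γ := A ⟶' Fm.bot

/-- The true formula. -/
def Fm.top {Γ : Ctx} : Fm Γ := Fm.bot ⟶' Fm.bot

/-! ### Renaming and substitution -/

/-- Renamings of variables. -/
abbrev Ren (Γ Δ : Ctx) : Type := ∀ τ : Ty, Var Γ τ → Var Δ τ

/-- Simultaneous substitutions. -/
abbrev Sub (Γ Δ : Ctx) : Type := ∀ τ : Ty, Var Γ τ → Tm Δ τ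

def Tm.rename {Γ Δ : Ctx} (r : Ren Γ Δ) : {τ : Ty} → Tm Γ τ → Tm Δ τ
  | _, .var x => .var (r _ x)
  | _, .zero => .zero
  | _, .succ => .succ
  | _, .K ρ τ => .K ρ τ
  | _, .S δ ρ τ => .S δ ρ τ
  | _, .R => .R
  | _, .app f a => .app (f.rename r) (a.rename r)

/-- Weakening by one new variable. -/
def Tm.wk {Γ : Ctx} {σ τ : Ty} (t : Tm Γ τ) : Tm (σ :: Γ) τ := t.rename fun _ x => x.s

/-- A closed term in an arbitrary context. -/
def Tm.closed {Γ : Ctx} {τ : Ty} (t : Tm [] τ) : Tm Γ τ := t.rename fun _ x => by cases x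

def Tm.subst {Γ Δ : Ctx} (θ : Sub Γ Δ) : {τ : Ty} → Tm Γ τ → Tm Δ τ
  | _, .var x => θ _ x
  | _, .zero => .zero
  | _, .succ => .succ
  | _, .K ρ τ => .K ρ τ
  | _, .S δ ρ τ => .S δ ρ τ
  | _, .R => .R
  | _, .app f a => .app (f.subst θ) (a.subst θ)

/-- `Sub.cons t θ` sends variable `0` to `t` and the other variables where `θ` sends them. -/
def Sub.cons {Γ Δ : Ctx} {σ : Ty} (t : Tm Δ σ) (θ : Sub Γ Δ) : Sub (σ :: Γ) Δ
  | _, .z => t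
  | _, .s x => θ _ x

/-- The identity substitution. -/
def Sub.id (Γ : Ctx) : Sub Γ Γ := fun _ x => .var x

/-- The substitution `θ` followed by weakening. -/
def Sub.wk {Γ Δ : Ctx} (σ : Ty) (θ : Sub Γ Δ) : Sub Γ (σ :: Δ) := fun _ x => (θ _ x).wk

/-- A substitution carried under a quantifier. -/
def Sub.lift {Γ Δ : Ctx} (σ : Ty) (θ : Sub Γ Δ) : Sub (σ :: Γ) (σ :: Δ) :=
  Sub.cons (.var .z) (θ.wk σ)

def Fm.subst : {Γ Δ : Ctx} → Sub Γ Δ → Fm Γ → Fm Δ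
  | _, _, θ, .eq s t => .eq (s.subst θ) (t.subst θ)
  | _, _, _, .bot => .bot
  | _, _, θ, .and A B => .and (A.subst θ) (B.subst θ)
  | _, _, θ, .or A B => .or (A.subst θ) (B.subst θ)
  | _, _, θ, .imp A B => .imp (A.subst θ) (B.subst θ)
  | _, _, θ, .all σ A => .all σ (A.subst (θ.lift σ))
  | _, _, θ, .ex σ A => .ex σ (A.subst (θ.lift σ))

/-- Weakening of a formula by one new variable. -/
def Fm.wk {Γ : Ctx} {σ : Ty} (A : Fm Γ) : Fm (σ :: Γ) := A.subst ((Sub.id Γ).wk σ)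

/-- Instantiation of variable `0` by a term. -/
def Fm.inst {Γ : Ctx} {σ : Ty} (A : Fm (σ :: Γ)) (t : Tm Γ σ) : Fm Γ :=
  A.subst (Sub.cons t (Sub.id Γ))

/-! ### The axioms -/

/-- Quantifier-free formulas. -/
def Fm.QF : {Γ : Ctx} → Fm Γ → Prop
  | _, .eq _ _ => True
  | _, .bot => True
  | _, .and A B => A.QF ∧ B.QF
  | _, .or A B => A.QF ∧ B.QF
  | _, .imp A B => A.QF ∧ B.QF
  | _, .all _ _ => False
  | _, .ex _ _ => False

/-- Equality at an arbitrary type, defined pointwise from equality of type `0`. -/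
def eqAt : {Γ : Ctx} → (τ : Ty) → Tm Γ τ → Tm Γ τ → Fm Γ
  | _, .nat, s, t => s ≐ t
  | _, .arr ρ τ, s, t => .all ρ (eqAt τ (s.wk ⬝ .var .z) (t.wk ⬝ .var .z))

/-- The nonlogical axioms, with arbitrary terms in place of the universally quantified
variables. -/
inductive Ax : {Γ : Ctx} → Fm Γ → Prop
  | eq_refl {Γ : Ctx} (t : Tm Γ .nat) : Ax (t ≐ t)
  | eq_symm {Γ : Ctx} (s t : Tm Γ .nat) : Ax (s ≐ t ⟶' t ≐ s)
  | eq_trans {Γ : Ctx} (s t u : Tm Γ .nat) : Ax (s ≐ t ⟶' t ≐ u ⟶' s ≐ u)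
  /-- Extensionality at all types. -/
  | ext {Γ : Ctx} {ρ τ : Ty} (f : Tm Γ (ρ ⇒ τ)) (s t : Tm Γ ρ) :
      Ax (eqAt ρ s t ⟶' eqAt τ (f ⬝ s) (f ⬝ t))
  | succ_ne_zero {Γ : Ctx} (t : Tm Γ .nat) : Ax (Fm.neg (.succ ⬝ t ≐ .zero))
  | succ_inj {Γ : Ctx} (s t : Tm Γ .nat) : Ax (.succ ⬝ s ≐ .succ ⬝ t ⟶' s ≐ t)
  | K_eq {Γ : Ctx} {ρ τ : Ty} (s : Tm Γ ρ) (t : Tm Γ τ) : Ax (eqAt ρ (.K ρ τ ⬝ s ⬝ t) s)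
  | S_eq {Γ : Ctx} {δ ρ τ : Ty} (s : Tm Γ (δ ⇒ ρ ⇒ τ)) (t : Tm Γ (δ ⇒ ρ)) (u : Tm Γ δ) :
      Ax (eqAt τ (.S δ ρ τ ⬝ s ⬝ t ⬝ u) (s ⬝ u ⬝ (t ⬝ u)))
  | R_zero {Γ : Ctx} (y : Tm Γ .nat) (z : Tm Γ (.nat ⇒ .nat ⇒ .nat)) :
      Ax (.R ⬝ .zero ⬝ y ⬝ z ≐ y)
  | R_succ {Γ : Ctx} (x y : Tm Γ .nat) (z : Tm Γ (.nat ⇒ .nat ⇒ .nat)) :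
      Ax (.R ⬝ (.succ ⬝ x) ⬝ y ⬝ z ≐ z ⬝ (.R ⬝ x ⬝ y ⬝ z) ⬝ x)
  /-- Induction for quantifier-free formulas, with parameters. -/
  | ind {Γ : Ctx} (A : Fm (.nat :: Γ)) : A.QF →
      Ax (A.inst .zero ⋏
          .all .nat (A ⟶' A.subst (Sub.cons (.succ ⬝ .var .z) ((Sub.id Γ).wk .nat)))
        ⟶' .all .nat A)
  /-- `QF-AC^{1,0}`: if `∀ x¹ ∃ n⁰ A(x,n)` with `A` quantifier-free, then there is `Φ` of type
  `1 ⇒ 0` with `∀ x A(x, Φ x)`. In `A`, variable `0` is `n` and variable `1` is `x`. -/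
  | choice {Γ : Ctx} (A : Fm (.nat :: .one :: Γ)) : A.QF →
      Ax (.all .one (.ex .nat A) ⟶'
        .ex (.one ⇒ .nat) (.all .one (A.subst
          (Sub.cons (.var (.s .z) ⬝ .var .z)
            (Sub.cons (.var .z) (((Sub.id Γ).wk (.one ⇒ .nat)).wk .one))))))

/-! ### Intuitionistic natural deduction -/

/-- `Prf H A`: the formula `A` is derivable from the axioms and the hypotheses `H` in
intuitionistic many-sorted predicate logic. -/
inductive Prf : {Γ : Ctx} → List (Fm Γ) → Fm Γ → Prop
  | ax {Γ : Ctx} {H : List (Fm Γ)} {A : Fm Γ} : Ax A → Prf H A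
  | hyp {Γ : Ctx} {H : List (Fm Γ)} {A : Fm Γ} : A ∈ H → Prf H A
  | botE {Γ : Ctx} {H : List (Fm Γ)} {A : Fm Γ} : Prf H .bot → Prf H A
  | andI {Γ : Ctx} {H : List (Fm Γ)} {A B : Fm Γ} : Prf H A → Prf H B → Prf H (A ⋏ B)
  | andE₁ {Γ : Ctx} {H : List (Fm Γ)} {A B : Fm Γ} : Prf H (A ⋏ B) → Prf H A
  | andE₂ {Γ : Ctx} {H : List (Fm Γ)} {A B : Fm Γ} : Prf H (A ⋏ B) → Prf H B
  | orI₁ {Γ : Ctx} {H : List (Fm Γ)} {A B : Fm Γ} : Prf H A → Prf H (A ⋎ B)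
  | orI₂ {Γ : Ctx} {H : List (Fm Γ)} {A B : Fm Γ} : Prf H B → Prf H (A ⋎ B)
  | orE {Γ : Ctx} {H : List (Fm Γ)} {A B C : Fm Γ} :
      Prf H (A ⋎ B) → Prf (A :: H) C → Prf (B :: H) C → Prf H C
  | impI {Γ : Ctx} {H : List (Fm Γ)} {A B : Fm Γ} : Prf (A :: H) B → Prf H (A ⟶' B)
  | impE {Γ : Ctx} {H : List (Fm Γ)} {A B : Fm Γ} : Prf H (A ⟶' B) → Prf H A → Prf H B
  | allI {Γ : Ctx} {H : List (Fm Γ)} {σ : Ty} {A : Fm (σ :: Γ)} :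
      Prf (H.map Fm.wk) A → Prf H (.all σ A)
  | allE {Γ : Ctx} {H : List (Fm Γ)} {σ : Ty} {A : Fm (σ :: Γ)} (t : Tm Γ σ) :
      Prf H (.all σ A) → Prf H (A.inst t)
  | exI {Γ : Ctx} {H : List (Fm Γ)} {σ : Ty} {A : Fm (σ :: Γ)} (t : Tm Γ σ) :
      Prf H (A.inst t) → Prf H (.ex σ A)
  | exE {Γ : Ctx} {H : List (Fm Γ)} {σ : Ty} {A : Fm (σ :: Γ)} {C : Fm Γ} :
      Prf H (.ex σ A) → Prf (A :: H.map Fm.wk) C.wk → Prf H C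

/-- `iRCA₀^ω ⊢ A` for a sentence `A`. -/
def Provable (A : Fm []) : Prop := Prf [] A

/-! ### Primitive recursive terms -/

/-- Abstraction of variable `0`, expressed by the combinators. -/
def Tm.lam {Γ : Ctx} {σ : Ty} : {τ : Ty} → Tm (σ :: Γ) τ → Tm Γ (σ ⇒ τ)
  | _, .var .z => .S σ (σ ⇒ σ) σ ⬝ .K σ (σ ⇒ σ) ⬝ .K σ σ
  | _, .var (.s x) => .K _ σ ⬝ .var x
  | _, .zero => .K _ σ ⬝ .zero
  | _, .succ => .K _ σ ⬝ .succ
  | _, .K ρ τ => .K _ σ ⬝ .K ρ τ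
  | _, .S δ ρ τ => .K _ σ ⬝ .S δ ρ τ
  | _, .R => .K _ σ ⬝ .R
  | _, .app (ρ := ρ) (τ := τ) f a => .S σ ρ τ ⬝ f.lam ⬝ a.lam

section Arithmetic

variable {Γ : Ctx}

/-- Variable `0`. -/
abbrev v0 {σ : Ty} : Tm (σ :: Γ) σ := .var .z

/-- Variable `1`. -/
abbrev v1 {σ τ : Ty} : Tm (τ :: σ :: Γ) σ := .var (.s .z)

/-- Variable `2`. -/
abbrev v2 {σ τ υ : Ty} : Tm (υ :: τ :: σ :: Γ) σ := .var (.s (.s .z))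

/-- Variable `3`. -/
abbrev v3 {σ τ υ φ : Ty} : Tm (φ :: υ :: τ :: σ :: Γ) σ := .var (.s (.s (.s .z)))

/-- Predecessor: `pred 0 = 0` and `pred (i+1) = i`. -/
def predT : Tm Γ (.nat ⇒ .nat) := .lam (.R ⬝ v0 ⬝ .zero ⬝ .lam (.lam v0))

/-- Addition, by recursion on the second argument. -/
def addT : Tm Γ (.nat ⇒ .nat ⇒ .nat) :=
  .lam (.lam (.R ⬝ v0 ⬝ v1 ⬝ .lam (.lam (.succ ⬝ v1))))

/-- Truncated subtraction, by recursion on the second argument. -/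
def subT : Tm Γ (.nat ⇒ .nat ⇒ .nat) :=
  .lam (.lam (.R ⬝ v0 ⬝ v1 ⬝ .lam (.lam (predT ⬝ v1))))

/-- `triT 0 = 0` and `triT (b+1) = triT b + b`, so `triT b = b (b - 1) / 2`. -/
def triT : Tm Γ (.nat ⇒ .nat) := .lam (.R ⬝ v0 ⬝ .zero ⬝ .lam (.lam (addT ⬝ v1 ⬝ v0)))

/-- The code `b (b - 1) / 2 + a` of a pair `(a, b)`; it maps the increasing pairs `a < b`
bijectively onto the natural numbers. -/
def codeT : Tm Γ (.nat ⇒ .nat ⇒ .nat) := .lam (.lam (addT ⬝ (triT ⬝ v0) ⬝ v1))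

/-- The numeral of `n`. -/
def num : ℕ → Tm Γ .nat
  | 0 => .zero
  | n + 1 => .succ ⬝ num n

/-- `s ≤ t`. -/
def le (s t : Tm Γ .nat) : Fm Γ := subT ⬝ s ⬝ t ≐ .zero

/-- `s < t`. -/
def lt (s t : Tm Γ .nat) : Fm Γ := le (.succ ⬝ s) t

end Arithmetic

/-! ### Problems and formalized Weihrauch reducibility -/

/-- A problem `∀ x (dom x → ∃ y sol x y)` with inputs of type `ρ` and outputs of type `τ`,
possibly with parameters from `Γ`. In `dom`, variable `0` is `x`; in `sol`, variable `0` is `y`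
and variable `1` is `x`. -/
structure Problem (Γ : Ctx) (ρ τ : Ty) where
  dom : Fm (ρ :: Γ)
  sol : Fm (τ :: ρ :: Γ)

/-- The formula `Q ≤_W P`:
`∃ Φ ∃ Ψ ∀ u ∀ y (q₁(u) → (p₁(Φ u) ∧ (p₂(Φ u, y) → q₂(u, Ψ y))))`.
Below the four quantifiers, the variables `0, 1, 2, 3` are `y, u, Ψ, Φ`. -/
def Problem.reduces {Γ : Ctx} {ρ τ ρ' τ' : Ty} (Q : Problem Γ ρ' τ') (P : Problem Γ ρ τ) :
    Fm Γ :=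
  let par : Sub Γ (τ :: ρ' :: (τ ⇒ τ') :: (ρ' ⇒ ρ) :: Γ) :=
    ((((Sub.id Γ).wk (ρ' ⇒ ρ)).wk (τ ⇒ τ')).wk ρ').wk τ
  .ex (ρ' ⇒ ρ) (.ex (τ ⇒ τ') (.all ρ' (.all τ
    (Q.dom.subst (Sub.cons v1 par) ⟶'
      P.dom.subst (Sub.cons (v3 ⬝ v1) par) ⋏
        (P.sol.subst (Sub.cons v0 (Sub.cons (v3 ⬝ v1) par)) ⟶'
          Q.sol.subst (Sub.cons (v2 ⬝ v0) (Sub.cons v1 par)))))))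

/-- The formula `P ≡_W Q`. -/
def Problem.equiv {Γ : Ctx} {ρ τ ρ' τ' : Ty} (P : Problem Γ ρ τ) (Q : Problem Γ ρ' τ') : Fm Γ :=
  P.reduces Q ⋏ Q.reduces P

/-- `LPO`, a total problem with input `p` of type `1` and output a number `n`:
`(n = 0 → ∀ i p(i) > 0) ∧ (n > 0 → (p(n-1) = 0 ∧ ∀ t (t < n-1 → p(t) > 0)))`. -/
def LPO (Γ : Ctx) : Problem Γ .one .nat where
  dom := .top
  sol :=
    (v0 ≐ .zero ⟶' .all .nat (lt .zero (v2 ⬝ v0))) ⋏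
    (lt .zero v0 ⟶'
      (v1 ⬝ (predT ⬝ v0) ≐ .zero ⋏
        .all .nat (lt v0 (predT ⬝ v1) ⟶' lt .zero (v2 ⬝ v0))))

/-- `(a, b) ∈ G`, for `a < b`, where `e` of type `1` codes the edge set of `G`. -/
def edge {Γ : Ctx} (e : Tm Γ .one) (a b : Tm Γ .nat) : Fm Γ :=
  .neg (e ⬝ (codeT ⬝ a ⬝ b) ≐ .zero)

/-- `G_m`, the subgraph of `G` on the vertices `0, …, m`, has a `k`-coloring: there is `f` such
that `f(a) < k` for all `a ≤ m`, and `f(a) ≠ f(b)` whenever `a < b ≤ m` and `(a, b) ∈ G`. -/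
def colorable {Γ : Ctx} (k : Tm Γ .nat) (e : Tm Γ .one) (m : Tm Γ .nat) : Fm Γ :=
  .ex .one
    (.all .nat (le v0 m.wk.wk ⟶' lt (v1 ⬝ v0) k.wk.wk) ⋏
     .all .nat (.all .nat (lt v1 v0 ⟶' le v0 m.wk.wk.wk ⟶' edge e.wk.wk.wk v1 v0 ⟶'
        .neg (v2 ⬝ v1 ≐ v2 ⬝ v0))))

/-- The type of functionals `c(k, G, m)`. -/
abbrev Ty.col : Ty := .nat ⇒ .one ⇒ .nat ⇒ .nat

/-- The sentence saying that `c` is the characteristic function of colorability: for all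
`k, G, m`, either `G_m` has a `k`-coloring and `c(k,G,m) = 1`, or `G_m` has no `k`-coloring and
`c(k,G,m) = 0`. -/
def decidesColorable (c : Tm [] .col) : Fm [] :=
  .all .nat (.all .one (.all .nat
    (colorable v2 v1 v0 ⋏ c.closed ⬝ v2 ⬝ v1 ⬝ v0 ≐ num 1 ⋎
      (colorable v2 v1 v0).neg ⋏ c.closed ⬝ v2 ⬝ v1 ⬝ v0 ≐ .zero)))

/-- `LGk`, a total problem with input a graph `G`, coded by a function of type `1`, and output a
number `n`, formalized with the help of `c`:
`(n = 0 → ∀ m c(k,G,m) = 1) ∧ (n > 0 → (c(k,G,n) = 0 ∧ ∀ t (t < n → c(k,G,t) = 1)))`. -/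
def LG (c : Tm [] .col) {Γ : Ctx} (k : Tm Γ .nat) : Problem Γ .one .nat where
  dom := .top
  sol :=
    (v0 ≐ .zero ⟶' .all .nat (c.closed ⬝ k.wk.wk.wk ⬝ v2 ⬝ v0 ≐ num 1)) ⋏
    (lt .zero v0 ⟶'
      (c.closed ⬝ k.wk.wk ⬝ v1 ⬝ v0 ≐ .zero ⋏
        .all .nat (lt v0 v1 ⟶' c.closed ⬝ k.wk.wk.wk ⬝ v2 ⬝ v0 ≐ num 1)))

/-- The sentence `∀ k ∀ j (1 ≤ k → k ≤ j → (LPO ≡_W LGk ∧ LGk ≡_W LGj))`. -/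
def localColoringSentence (c : Tm [] .col) : Fm [] :=
  .all .nat (.all .nat
    (le (num 1) v1 ⟶' le v1 v0 ⟶'
      (LPO [.nat, .nat]).equiv (LG c v1) ⋏ (LG c v1).equiv (LG c v0)))

end IRCA

/-! To `p` assign the graph in which `a < b` are joined exactly when `p` has a zero below `b`. If
`p` has no zero, there are no edges, and every finite part is `k`-colorable because `1 ≤ k`. If `i`
is the least zero, then `0, …, i` are pairwise unjoined and every later vertex is joined to all
others, so for `m ≥ i` exactly `m - i + 1` colors are needed on `0, …, m`. The first part without a
`k`-coloring is therefore the one with `m = i + k`, and a solution `n > 0` of `LGk` yields the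
solution `i + 1 = n + 1 - k` of `LPO`. Conversely, `LPO` applied to `m ↦ c(k,G,m)` solves `LGk`
after taking a predecessor; the value `0` stays unambiguous because a single vertex is always
`k`-colorable. Composing the two reductions through `LPO` compares `LGk` with `LGj`.

The lower bound on the number of colors is the pigeonhole principle, a statement about all functions
`f`, whereas induction is available for quantifier-free formulas only. Since `c` decides
colorability, "the complete graph on `k + 1` vertices has no `k`-coloring" becomes an equation for a
value of `c`, and induction on `k` applies (`Decides.complete_eq_zero`).

Most of the derivations are not written out. The functionals of a reduction are explicit terms, and
what remains to be derived contains neither `∨` nor `∃`. Equality of type `0` is decidable in the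
system, so such negative formulas are stable under double negation (`Prf.stable`), and a Henkin
construction shows that a negative formula true in all models of the negative hypotheses is
derivable intuitionistically (`complete`). Inside a model the reasoning is classical, with induction
for the zero sets of represented functions. The hypothesis on `c` enters through its two negative
consequences.

The existence of `c` is shown by a bounded search: a coloring of `0, …, m` is read as a word of `m +
1` digits in base `k`, that is, as a number below `k ^ (m + 1)`. -/

namespace IRCA

/-! ### The calculus of substitutions -/

/-- The substitution `θ` followed by `η`. -/
def Sub.comp {Γ Δ Ξ : Ctx} (θ : Sub Γ Δ) (η : Sub Δ Ξ) : Sub Γ Ξ := fun _ x => (θ _ x).subst η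

/-- Weakening by one variable, as a substitution. -/
abbrev Sub.shift (Γ : Ctx) (σ : Ty) : Sub Γ (σ :: Γ) := (Sub.id Γ).wk σ

/-- The substitution out of the empty context. -/
def Sub.nil (Γ : Ctx) : Sub [] Γ := fun _ x => nomatch x

theorem Sub.ext_cons {Γ Δ : Ctx} {σ : Ty} {θ η : Sub (σ :: Γ) Δ}
    (h0 : θ _ .z = η _ .z) (hs : ∀ τ (x : Var Γ τ), θ _ x.s = η _ x.s) : θ = η := by
  funext τ x
  cases x with
  | z => exact h0
  | s x => exact hs _ x

theorem Tm.rename_eq_subst {Γ Δ : Ctx} (r : Ren Γ Δ) {τ : Ty} (t : Tm Γ τ) :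
    t.rename r = t.subst fun _ x => .var (r _ x) := by
  induction t with
  | app f a hf ha => simp [Tm.rename, Tm.subst, hf, ha]
  | _ => rfl

theorem Tm.wk_eq_subst {Γ : Ctx} {σ τ : Ty} (t : Tm Γ τ) :
    (t.wk : Tm (σ :: Γ) τ) = t.subst (Sub.shift Γ σ) := by
  rw [Tm.wk, Tm.rename_eq_subst]; rfl

theorem Tm.closed_eq_subst {Γ : Ctx} {τ : Ty} (t : Tm [] τ) :
    (t.closed : Tm Γ τ) = t.subst (Sub.nil Γ) := by
  rw [Tm.closed, Tm.rename_eq_subst]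
  congr 1
  funext _ x
  cases x

theorem Tm.subst_subst {Γ Δ Ξ : Ctx} (θ : Sub Γ Δ) (η : Sub Δ Ξ) {τ : Ty} (t : Tm Γ τ) :
    (t.subst θ).subst η = t.subst (θ.comp η) := by
  induction t with
  | app f a hf ha => simp [Tm.subst, hf, ha]
  | _ => rfl

@[simp] theorem Tm.subst_id {Γ : Ctx} {τ : Ty} (t : Tm Γ τ) : t.subst (Sub.id Γ) = t := by
  induction t with
  | app f a hf ha => simp [Tm.subst, hf, ha]
  | _ => rfl

theorem Sub.wk_eq_comp {Γ Δ : Ctx} (σ : Ty) (θ : Sub Γ Δ) : θ.wk σ = θ.comp (Sub.shift Δ σ) := by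
  funext τ x
  exact Tm.wk_eq_subst _

theorem Sub.comp_assoc {Γ Δ Ξ Θ : Ctx} (θ : Sub Γ Δ) (η : Sub Δ Ξ) (ζ : Sub Ξ Θ) :
    (θ.comp η).comp ζ = θ.comp (η.comp ζ) := by
  funext τ x
  exact Tm.subst_subst _ _ _

@[simp] theorem Sub.id_comp {Γ Δ : Ctx} (θ : Sub Γ Δ) : (Sub.id Γ).comp θ = θ := rfl

@[simp] theorem Sub.comp_id {Γ Δ : Ctx} (θ : Sub Γ Δ) : θ.comp (Sub.id Δ) = θ := by
  funext τ x
  exact Tm.subst_id _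

@[simp] theorem Sub.cons_comp {Γ Δ Ξ : Ctx} {σ : Ty} (t : Tm Δ σ) (θ : Sub Γ Δ) (η : Sub Δ Ξ) :
    (Sub.cons t θ).comp η = Sub.cons (t.subst η) (θ.comp η) :=
  Sub.ext_cons rfl fun _ _ => rfl

@[simp] theorem Sub.shift_comp_cons {Γ Δ : Ctx} {σ : Ty} (t : Tm Δ σ) (θ : Sub Γ Δ) :
    (Sub.shift Γ σ).comp (Sub.cons t θ) = θ := rfl

@[simp] theorem Sub.wk_comp_cons {Γ Δ Ξ : Ctx} {σ : Ty} (t : Tm Ξ σ) (θ : Sub Γ Δ) (η : Sub Δ Ξ) :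
    (θ.wk σ).comp (Sub.cons t η) = θ.comp η := by
  rw [Sub.wk_eq_comp, Sub.comp_assoc, Sub.shift_comp_cons]

@[simp] theorem Sub.lift_comp_cons {Γ Δ Ξ : Ctx} {σ : Ty} (t : Tm Ξ σ) (θ : Sub Γ Δ)
    (η : Sub Δ Ξ) : (θ.lift σ).comp (Sub.cons t η) = Sub.cons t (θ.comp η) := by
  simp [Sub.lift, Tm.subst, Sub.cons]

theorem Sub.wk_comp_lift {Γ Δ Ξ : Ctx} {σ : Ty} (θ : Sub Γ Δ) (η : Sub Δ Ξ) :
    (θ.wk σ).comp (η.lift σ) = (θ.comp η).wk σ := by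
  rw [Sub.lift, Sub.wk_comp_cons, Sub.wk_eq_comp, Sub.wk_eq_comp, Sub.comp_assoc]

theorem Sub.lift_comp_lift {Γ Δ Ξ : Ctx} {σ : Ty} (θ : Sub Γ Δ) (η : Sub Δ Ξ) :
    (θ.lift σ).comp (η.lift σ) = (θ.comp η).lift σ := by
  rw [Sub.lift, Sub.cons_comp, Sub.wk_comp_lift]; rfl

theorem Sub.comp_wk {Γ Δ Ξ : Ctx} {σ : Ty} (θ : Sub Γ Δ) (η : Sub Δ Ξ) :
    θ.comp (η.wk σ) = (θ.comp η).wk σ := by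
  rw [Sub.wk_eq_comp, Sub.wk_eq_comp, Sub.comp_assoc]

theorem Sub.cons_var_shift (Γ : Ctx) (σ : Ty) :
    Sub.cons (.var .z) (Sub.shift Γ σ) = Sub.id (σ :: Γ) :=
  Sub.ext_cons rfl fun _ _ => rfl

@[simp] theorem Sub.lift_id (Γ : Ctx) (σ : Ty) : (Sub.id Γ).lift σ = Sub.id (σ :: Γ) :=
  Sub.cons_var_shift Γ σ

theorem Fm.subst_subst {Γ Δ Ξ : Ctx} (θ : Sub Γ Δ) (η : Sub Δ Ξ) (A : Fm Γ) :
    (A.subst θ).subst η = A.subst (θ.comp η) := by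
  induction A generalizing Δ Ξ with
  | eq s t => simp [Fm.subst, Tm.subst_subst]
  | bot => rfl
  | and A B hA hB => simp [Fm.subst, hA, hB]
  | or A B hA hB => simp [Fm.subst, hA, hB]
  | imp A B hA hB => simp [Fm.subst, hA, hB]
  | all σ A hA => simp [Fm.subst, hA, Sub.lift_comp_lift]
  | ex σ A hA => simp [Fm.subst, hA, Sub.lift_comp_lift]

@[simp] theorem Fm.subst_id {Γ : Ctx} (A : Fm Γ) : A.subst (Sub.id Γ) = A := by
  induction A with
  | eq s t => simp [Fm.subst]
  | bot => rfl
  | and A B hA hB => simp [Fm.subst, hA, hB]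
  | or A B hA hB => simp [Fm.subst, hA, hB]
  | imp A B hA hB => simp [Fm.subst, hA, hB]
  | all σ A hA => simp [Fm.subst, hA]
  | ex σ A hA => simp [Fm.subst, hA]

@[simp] theorem Tm.wk_subst_cons {Γ Δ : Ctx} {σ τ : Ty} (s : Tm Γ τ) (t : Tm Δ σ) (θ : Sub Γ Δ) :
    s.wk.subst (Sub.cons t θ) = s.subst θ := by
  rw [Tm.wk_eq_subst, Tm.subst_subst, Sub.shift_comp_cons]

theorem Tm.wk_subst_lift {Γ Δ : Ctx} {σ τ : Ty} (s : Tm Γ τ) (θ : Sub Γ Δ) :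
    s.wk.subst (θ.lift σ) = (s.subst θ).wk := by
  rw [Sub.lift, Tm.wk_subst_cons, Tm.wk_eq_subst, Tm.subst_subst, Sub.wk_eq_comp]

theorem Fm.wk_subst_lift {Γ Δ : Ctx} {σ : Ty} (A : Fm Γ) (θ : Sub Γ Δ) :
    A.wk.subst (θ.lift σ) = (A.subst θ).wk := by
  simp only [Fm.wk, Fm.subst_subst]
  rw [Sub.wk_comp_lift, Sub.id_comp, Sub.wk_eq_comp]

theorem Fm.inst_subst {Γ Δ : Ctx} {σ : Ty} (A : Fm (σ :: Γ)) (t : Tm Γ σ) (θ : Sub Γ Δ) :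
    (A.inst t).subst θ = (A.subst (θ.lift σ)).inst (t.subst θ) := by
  simp [Fm.inst, Fm.subst_subst]

/-- Weakening under a quantifier and instantiating with the fresh variable cancel; this is what
makes the introduction of `∀` invertible. -/
theorem Fm.lift_shift_inst_var {Γ : Ctx} {σ : Ty} (A : Fm (σ :: Γ)) :
    (A.subst ((Sub.shift Γ σ).lift σ)).inst (.var .z) = A := by
  simp [Fm.inst, Fm.subst_subst, Sub.cons_var_shift]

theorem eqAt_subst {Γ Δ : Ctx} (τ : Ty) (s t : Tm Γ τ) (θ : Sub Γ Δ) :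
    (eqAt τ s t).subst θ = eqAt τ (s.subst θ) (t.subst θ) := by
  induction τ generalizing Γ Δ with
  | nat => rfl
  | arr ρ τ _ ih =>
    simp only [eqAt, Fm.subst, ih, Tm.subst, Tm.wk_subst_lift]
    rfl

theorem Fm.QF.subst {Γ Δ : Ctx} {A : Fm Γ} (h : A.QF) (θ : Sub Γ Δ) : (A.subst θ).QF := by
  induction A generalizing Δ with
  | eq s t => trivial
  | bot => trivial
  | and A B hA hB => exact ⟨hA h.1 θ, hB h.2 θ⟩
  | or A B hA hB => exact ⟨hA h.1 θ, hB h.2 θ⟩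
  | imp A B hA hB => exact ⟨hA h.1 θ, hB h.2 θ⟩
  | all σ A hA => exact h.elim
  | ex σ A hA => exact h.elim

/-! ### Structural properties of derivability -/

theorem Ax.subst {Γ Δ : Ctx} {A : Fm Γ} (h : Ax A) (θ : Sub Γ Δ) : Ax (A.subst θ) := by
  cases h with
  | eq_refl t => exact .eq_refl _
  | eq_symm s t => exact .eq_symm _ _
  | eq_trans s t u => exact .eq_trans _ _ _
  | ext f s t =>
    simp only [Fm.subst, eqAt_subst]
    exact .ext _ _ _
  | succ_ne_zero t => exact .succ_ne_zero _
  | succ_inj s t => exact .succ_inj _ _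
  | K_eq s t => rw [eqAt_subst]; exact .K_eq _ _
  | S_eq s t u => rw [eqAt_subst]; exact .S_eq _ _ _
  | R_zero y z => exact .R_zero _ _
  | R_succ x y z => exact .R_succ _ _ _
  | ind A hA =>
    -- Both schemes are instantiated at the substituted formula; the remaining work is to commute
    -- `θ` with the substitutions that occur in the scheme.
    have := Ax.ind (A.subst (θ.lift .nat)) (hA.subst _)
    simp only [Fm.subst, Fm.inst_subst, Fm.subst_subst] at this ⊢
    simpa [Tm.subst, Sub.wk_comp_lift, Sub.lift, Sub.cons, Sub.comp_wk] using this
  | choice A hA =>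
    have := Ax.choice (A.subst ((θ.lift .one).lift .nat)) (hA.subst _)
    simp only [Fm.subst, Fm.subst_subst] at this ⊢
    simp only [Tm.subst, Sub.cons_comp, Sub.wk_comp_cons, Sub.id_comp,
      Sub.comp_id, Sub.lift, Sub.cons, Sub.comp_wk] at this ⊢
    exact this

theorem Prf.subst {Γ Δ : Ctx} {H : List (Fm Γ)} {A : Fm Γ} (h : Prf H A) (θ : Sub Γ Δ) :
    Prf (H.map (Fm.subst θ)) (A.subst θ) := by
  have key : ∀ {Γ Δ : Ctx} (σ : Ty) (θ : Sub Γ Δ) (H : List (Fm Γ)),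
      (H.map (Fm.wk (σ := σ))).map (Fm.subst (θ.lift σ)) = (H.map (Fm.subst θ)).map Fm.wk := by
    intro Γ Δ σ θ H
    simp [Fm.wk_subst_lift]
  induction h generalizing Δ with
  | ax h => exact .ax (h.subst θ)
  | hyp h => exact .hyp (List.mem_map_of_mem h)
  | botE _ ih => exact .botE (ih θ)
  | andI _ _ ih₁ ih₂ => exact .andI (ih₁ θ) (ih₂ θ)
  | andE₁ _ ih => exact .andE₁ (ih θ)
  | andE₂ _ ih => exact .andE₂ (ih θ)
  | orI₁ _ ih => exact .orI₁ (ih θ)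
  | orI₂ _ ih => exact .orI₂ (ih θ)
  | orE _ _ _ ih₁ ih₂ ih₃ => exact .orE (ih₁ θ) (ih₂ θ) (ih₃ θ)
  | impI _ ih => exact .impI (ih θ)
  | impE _ _ ih₁ ih₂ => exact .impE (ih₁ θ) (ih₂ θ)
  | allI _ ih => exact .allI (key _ θ _ ▸ ih (θ.lift _))
  | allE t _ ih => rw [Fm.inst_subst]; exact .allE _ (ih θ)
  | exI t _ ih => exact .exI (t.subst θ) (Fm.inst_subst _ t θ ▸ ih θ)
  | exE _ _ ih₁ ih₂ =>
    refine .exE (ih₁ θ) ?_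
    have := ih₂ (θ.lift _)
    rwa [List.map_cons, key, Fm.wk_subst_lift] at this

theorem Prf.mono {Γ : Ctx} {H H' : List (Fm Γ)} {A : Fm Γ} (h : Prf H A) (hH : H ⊆ H') :
    Prf H' A := by
  induction h with
  | ax h => exact .ax h
  | hyp h => exact .hyp (hH h)
  | botE _ ih => exact .botE (ih hH)
  | andI _ _ ih₁ ih₂ => exact .andI (ih₁ hH) (ih₂ hH)
  | andE₁ _ ih => exact .andE₁ (ih hH)
  | andE₂ _ ih => exact .andE₂ (ih hH)
  | orI₁ _ ih => exact .orI₁ (ih hH)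
  | orI₂ _ ih => exact .orI₂ (ih hH)
  | orE _ _ _ ih₁ ih₂ ih₃ =>
    exact .orE (ih₁ hH) (ih₂ (List.cons_subset_cons _ hH)) (ih₃ (List.cons_subset_cons _ hH))
  | impI _ ih => exact .impI (ih (List.cons_subset_cons _ hH))
  | impE _ _ ih₁ ih₂ => exact .impE (ih₁ hH) (ih₂ hH)
  | allI _ ih => exact .allI (ih (List.map_subset _ hH))
  | allE t _ ih => exact .allE t (ih hH)
  | exI t _ ih => exact .exI t (ih hH)
  | exE _ _ ih₁ ih₂ => exact .exE (ih₁ hH) (ih₂ (List.cons_subset_cons _ (List.map_subset _ hH)))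

theorem Prf.wk {Γ : Ctx} {σ : Ty} {H : List (Fm Γ)} {A : Fm Γ} (h : Prf H A) :
    Prf (H.map (Fm.wk (σ := σ))) A.wk :=
  h.subst _

theorem Prf.weaken {Γ : Ctx} {H : List (Fm Γ)} {A B : Fm Γ} (h : Prf H A) : Prf (B :: H) A :=
  h.mono (List.subset_cons_self _ _)

theorem Prf.cut {Γ : Ctx} {H : List (Fm Γ)} {A B : Fm Γ} (h : Prf H A) (h' : Prf (A :: H) B) :
    Prf H B :=
  .impE (.impI h') h

theorem Prf.head {Γ : Ctx} {H : List (Fm Γ)} {A : Fm Γ} : Prf (A :: H) A :=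
  .hyp List.mem_cons_self

theorem Prf.of_sentence {Γ : Ctx} {H : List (Fm Γ)} {A : Fm []} (h : Provable A) :
    Prf H (A.subst (Sub.nil Γ)) :=
  (Prf.subst h (Sub.nil Γ)).mono (List.nil_subset _)

/-- The rule inverse to the introduction of `∀`. -/
theorem Prf.ofAll {Γ : Ctx} {σ : Ty} {H : List (Fm Γ)} {A : Fm (σ :: Γ)} (h : Prf H (.all σ A)) :
    Prf (H.map Fm.wk) A := by
  have := Prf.allE (.var .z) (h.wk (σ := σ))
  rwa [Fm.lift_shift_inst_var] at this

/-! ### Equality at all types -/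

section Equality

variable {Γ : Ctx} {H : List (Fm Γ)}

theorem Prf.eqAt_refl {τ : Ty} (t : Tm Γ τ) : Prf H (eqAt τ t t) := by
  induction τ generalizing Γ with
  | nat => exact .ax (.eq_refl t)
  | arr ρ τ _ ih => exact .allI (ih _)

theorem eqAt_arr_inst {ρ τ : Ty} (f g : Tm Γ (ρ ⇒ τ)) (a : Tm Γ ρ) :
    (eqAt τ (f.wk ⬝ .var .z) (g.wk ⬝ .var .z)).inst a = eqAt τ (f ⬝ a) (g ⬝ a) := by
  simp [Fm.inst, eqAt_subst, Tm.subst, Sub.cons]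

theorem Prf.eqAt_app {ρ τ : Ty} {f g : Tm Γ (ρ ⇒ τ)} (h : Prf H (eqAt (ρ ⇒ τ) f g))
    (a : Tm Γ ρ) : Prf H (eqAt τ (f ⬝ a) (g ⬝ a)) := by
  have := Prf.allE a h
  rwa [eqAt_arr_inst] at this

theorem Prf.eqAt_symm {τ : Ty} {s t : Tm Γ τ} (h : Prf H (eqAt τ s t)) : Prf H (eqAt τ t s) := by
  induction τ generalizing Γ with
  | nat => exact .impE (.ax (.eq_symm s t)) h
  | arr ρ τ _ ih => exact .allI (ih h.ofAll)

theorem Prf.eqAt_trans {τ : Ty} {s t u : Tm Γ τ} (h : Prf H (eqAt τ s t))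
    (h' : Prf H (eqAt τ t u)) : Prf H (eqAt τ s u) := by
  induction τ generalizing Γ with
  | nat => exact .impE (.impE (.ax (.eq_trans s t u)) h) h'
  | arr ρ τ _ ih => exact .allI (ih h.ofAll h'.ofAll)

/-- Replacing the function uses that higher equality is pointwise by definition; replacing the
argument uses the extensionality axiom. -/
theorem Prf.eqAt_congr {ρ τ : Ty} {f g : Tm Γ (ρ ⇒ τ)} {a b : Tm Γ ρ}
    (h : Prf H (eqAt (ρ ⇒ τ) f g)) (h' : Prf H (eqAt ρ a b)) :
    Prf H (eqAt τ (f ⬝ a) (g ⬝ b)) :=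
  (h.eqAt_app a).eqAt_trans (.impE (.ax (.ext g a b)) h')

theorem Prf.eqAt_K {ρ τ : Ty} (s : Tm Γ ρ) (t : Tm Γ τ) : Prf H (eqAt ρ (.K ρ τ ⬝ s ⬝ t) s) :=
  .ax (.K_eq s t)

/-- `β`-conversion for abstraction by combinators, under a substitution. -/
theorem Prf.beta {Δ : Ctx} {σ τ : Ty} (t : Tm (σ :: Δ) τ) (θ : Sub Δ Γ) (a : Tm Γ σ) :
    Prf H (eqAt τ (t.lam.subst θ ⬝ a) (t.subst (Sub.cons a θ))) := by
  induction t with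
  | var x =>
    cases x with
    | z => exact (Prf.ax (.S_eq _ _ _)).eqAt_trans (.eqAt_K _ _)
    | s x => exact .eqAt_K _ _
  | app f b hf hb => exact (Prf.ax (.S_eq _ _ _)).eqAt_trans (hf.eqAt_congr hb)
  | _ => exact .eqAt_K _ _

theorem Prf.beta₂ {Δ : Ctx} {σ ρ τ : Ty} (t : Tm (ρ :: σ :: Δ) τ) (θ : Sub Δ Γ) (a : Tm Γ σ)
    (b : Tm Γ ρ) :
    Prf H (eqAt τ (t.lam.lam.subst θ ⬝ a ⬝ b) (t.subst (Sub.cons b (Sub.cons a θ)))) :=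
  ((Prf.beta t.lam θ a).eqAt_app b).eqAt_trans (Prf.beta t _ b)

theorem Prf.rfl {t : Tm Γ .nat} : Prf H (t ≐ t) := .ax (.eq_refl t)

theorem Prf.symm {s t : Tm Γ .nat} (h : Prf H (s ≐ t)) : Prf H (t ≐ s) :=
  .impE (.ax (.eq_symm s t)) h

theorem Prf.trans {s t u : Tm Γ .nat} (h : Prf H (s ≐ t)) (h' : Prf H (t ≐ u)) : Prf H (s ≐ u) :=
  .impE (.impE (.ax (.eq_trans s t u)) h) h'

theorem Prf.congr₁ (f : Tm Γ .one) {s t : Tm Γ .nat} (h : Prf H (s ≐ t)) :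
    Prf H (f ⬝ s ≐ f ⬝ t) :=
  .impE (.ax (.ext (ρ := .nat) (τ := .nat) f s t)) h

theorem Prf.congr₂ (f : Tm Γ (.nat ⇒ .nat ⇒ .nat)) {s t s' t' : Tm Γ .nat} (h : Prf H (s ≐ t))
    (h' : Prf H (s' ≐ t')) : Prf H (f ⬝ s ⬝ s' ≐ f ⬝ t ⬝ t') :=
  Prf.eqAt_congr (ρ := .nat) (τ := .nat)
    (Prf.eqAt_congr (ρ := .nat) (τ := .nat ⇒ .nat) (.eqAt_refl f) h) h'

end Equality

/-! ### Arithmetic derived by hand, up to the decidability of equality -/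

section Arithmetic

variable {Γ : Ctx} {H : List (Fm Γ)}

/-- The rule of quantifier-free induction. -/
theorem Prf.induct {A : Fm (.nat :: Γ)} (hA : A.QF) (h0 : Prf H (A.inst .zero))
    (hs : Prf (A :: H.map Fm.wk) (A.subst (Sub.cons (.succ ⬝ .var .z) (Sub.shift Γ .nat))))
    (t : Tm Γ .nat) : Prf H (A.inst t) :=
  .allE t (.impE (.ax (.ind A hA)) (.andI h0 (.allI (.impI hs))))

theorem predT_subst {Δ : Ctx} (θ : Sub Γ Δ) : predT.subst θ = predT := by
  simp only [predT, Tm.lam, Tm.subst]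

theorem subT_subst {Δ : Ctx} (θ : Sub Γ Δ) : subT.subst θ = subT := by
  simp only [subT, predT, Tm.lam, Tm.subst]

theorem addT_subst {Δ : Ctx} (θ : Sub Γ Δ) : addT.subst θ = addT := by
  simp only [addT, Tm.lam, Tm.subst]

/-- The defining equation of `predT` by recursion. -/
theorem Prf.pred_eq (t : Tm Γ .nat) : Prf H (predT ⬝ t ≐ .R ⬝ t ⬝ .zero ⬝ .lam (.lam v0)) := by
  have := Prf.beta (H := H) (τ := .nat) (.R ⬝ v0 ⬝ .zero ⬝ .lam (.lam v0)) (Sub.id Γ) t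
  rw [Tm.subst_id] at this
  simpa only [eqAt, Tm.subst, Tm.lam, predT, Sub.cons] using this

theorem Prf.sub_eq (s t : Tm Γ .nat) :
    Prf H (subT ⬝ s ⬝ t ≐ .R ⬝ t ⬝ s ⬝ .lam (.lam (predT ⬝ v1))) := by
  have := Prf.beta₂ (H := H) (τ := .nat) (.R ⬝ v0 ⬝ v1 ⬝ .lam (.lam (predT ⬝ v1))) (Sub.id Γ) s t
  rw [Tm.subst_id] at this
  simpa only [eqAt, Tm.subst, Tm.lam, subT, predT, Sub.cons] using this

theorem Prf.add_eq (s t : Tm Γ .nat) :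
    Prf H (addT ⬝ s ⬝ t ≐ .R ⬝ t ⬝ s ⬝ .lam (.lam (.succ ⬝ v1))) := by
  have := Prf.beta₂ (H := H) (τ := .nat) (.R ⬝ v0 ⬝ v1 ⬝ .lam (.lam (.succ ⬝ v1))) (Sub.id Γ) s t
  rw [Tm.subst_id] at this
  simpa only [eqAt, Tm.subst, Tm.lam, addT, Sub.cons] using this

theorem Prf.pred_zero : Prf H (predT ⬝ .zero ≐ .zero) :=
  (Prf.pred_eq _).trans (.ax (.R_zero _ _))

theorem Prf.pred_succ (t : Tm Γ .nat) : Prf H (predT ⬝ (.succ ⬝ t) ≐ t) := by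
  refine ((Prf.pred_eq _).trans (.ax (.R_succ _ _ _))).trans ?_
  have (s : Tm Γ .nat) := Prf.beta₂ (H := H) (τ := .nat) v0 (Sub.id Γ) s t
  simp only [Tm.subst_id] at this
  exact this _

theorem Prf.sub_zero (s : Tm Γ .nat) : Prf H (subT ⬝ s ⬝ .zero ≐ s) :=
  (Prf.sub_eq _ _).trans (.ax (.R_zero _ _))

theorem Prf.sub_succ (s t : Tm Γ .nat) :
    Prf H (subT ⬝ s ⬝ (.succ ⬝ t) ≐ predT ⬝ (subT ⬝ s ⬝ t)) := by
  refine ((Prf.sub_eq _ _).trans (.ax (.R_succ _ _ _))).trans ?_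
  have (u : Tm Γ .nat) := Prf.beta₂ (H := H) (τ := .nat) (predT ⬝ v1) (Sub.id Γ) u t
  simp only [Tm.subst_id, Tm.subst, predT_subst, Sub.cons] at this
  exact Prf.trans (this _) (.congr₁ predT (Prf.sub_eq _ _).symm)

theorem Prf.add_zero (s : Tm Γ .nat) : Prf H (addT ⬝ s ⬝ .zero ≐ s) :=
  (Prf.add_eq _ _).trans (.ax (.R_zero _ _))

theorem Prf.add_succ (s t : Tm Γ .nat) :
    Prf H (addT ⬝ s ⬝ (.succ ⬝ t) ≐ .succ ⬝ (addT ⬝ s ⬝ t)) := by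
  refine ((Prf.add_eq _ _).trans (.ax (.R_succ _ _ _))).trans ?_
  have (u : Tm Γ .nat) := Prf.beta₂ (H := H) (τ := .nat) (.succ ⬝ v1) (Sub.id Γ) u t
  simp only [Tm.subst_id, Tm.subst, Sub.cons] at this
  exact Prf.trans (this _) (.congr₁ .succ (Prf.add_eq _ _).symm)

/-- Quantifier-free induction whose step does not need the induction hypothesis. The case
distinctions of the arithmetic below all come from here. -/
theorem Prf.zero_or_succ (t : Tm Γ .nat) :
    Prf H (t ≐ .zero ⋎ t ≐ .succ ⬝ (predT ⬝ t)) := by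
  have := Prf.induct (H := H) (A := v0 ≐ .zero ⋎ v0 ≐ .succ ⬝ (predT ⬝ v0)) (by simp [Fm.QF])
    (.orI₁ .rfl)
    (by
      simp only [Fm.subst, Tm.subst, predT_subst, Sub.cons]
      exact .orI₂ (.congr₁ .succ (Prf.pred_succ _).symm)) t
  simpa only [Fm.inst, Fm.subst, Tm.subst, predT_subst, Sub.cons] using this

/-- The recursion equations of `subT` govern its second argument; this gives access to the first, as
`Prf.sub_eq_pred` shows. -/
theorem Prf.pred_sub (s t : Tm Γ .nat) :
    Prf H (predT ⬝ (subT ⬝ s ⬝ t) ≐ subT ⬝ (predT ⬝ s) ⬝ t) := by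
  have := Prf.induct (H := H)
    (A := predT ⬝ (subT ⬝ s.wk ⬝ v0) ≐ subT ⬝ (predT ⬝ s.wk) ⬝ v0) (by simp [Fm.QF])
    (by
      simp only [Fm.inst, Fm.subst, Tm.subst, predT_subst, subT_subst, Tm.wk_subst_cons,
        Tm.subst_id, Sub.cons]
      exact (Prf.congr₁ predT (.sub_zero s)).trans (Prf.sub_zero _).symm)
    (by
      simp only [Fm.subst, Tm.subst, predT_subst, subT_subst, Tm.wk_subst_cons, Sub.cons,
        ← Tm.wk_eq_subst]
      exact (Prf.congr₁ predT ((Prf.sub_succ _ _).trans .head)).trans (Prf.sub_succ _ _).symm) t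
  simpa [Fm.inst, Fm.subst, Tm.subst, predT_subst, subT_subst, Sub.cons] using this

/-- `t ∸ s` is the predecessor of `(t + 1) ∸ s`. -/
theorem Prf.sub_eq_pred (s t : Tm Γ .nat) :
    Prf H (subT ⬝ t ⬝ s ≐ predT ⬝ (subT ⬝ (.succ ⬝ t) ⬝ s)) :=
  ((Prf.pred_sub _ _).trans (.congr₂ subT (.pred_succ t) .rfl)).symm

theorem Prf.succ_sub_self (t : Tm Γ .nat) :
    Prf H (subT ⬝ (.succ ⬝ t) ⬝ t ≐ .succ ⬝ .zero) := by
  have := Prf.induct (H := H) (A := subT ⬝ (.succ ⬝ v0) ⬝ v0 ≐ .succ ⬝ .zero) (by simp [Fm.QF])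
    (by
      simp only [Fm.inst, Fm.subst, Tm.subst, subT_subst, Sub.cons]
      exact Prf.sub_zero _)
    (by
      simp only [Fm.subst, Tm.subst, subT_subst, Sub.cons]
      exact ((Prf.sub_succ _ _).trans (Prf.sub_eq_pred _ _).symm).trans .head) t
  simpa only [Fm.inst, Fm.subst, Tm.subst, subT_subst, Sub.cons] using this

theorem Prf.sub_self (t : Tm Γ .nat) : Prf H (subT ⬝ t ⬝ t ≐ .zero) :=
  ((Prf.sub_eq_pred t t).trans (.congr₁ predT (.succ_sub_self t))).trans (.pred_succ _)

theorem Prf.succ_add (s t : Tm Γ .nat) :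
    Prf H (addT ⬝ (.succ ⬝ s) ⬝ t ≐ .succ ⬝ (addT ⬝ s ⬝ t)) := by
  have := Prf.induct (H := H)
    (A := addT ⬝ (.succ ⬝ s.wk) ⬝ v0 ≐ .succ ⬝ (addT ⬝ s.wk ⬝ v0)) (by simp [Fm.QF])
    (by
      simp only [Fm.inst, Fm.subst, Tm.subst, addT_subst, Tm.wk_subst_cons,
        Tm.subst_id, Sub.cons]
      exact (Prf.add_zero _).trans (Prf.congr₁ .succ (Prf.add_zero _).symm))
    (by
      simp only [Fm.subst, Tm.subst, addT_subst, Tm.wk_subst_cons, Sub.cons,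
        ← Tm.wk_eq_subst]
      exact (Prf.add_succ _ _).trans
        (.congr₁ .succ (Prf.head.trans (Prf.add_succ _ _).symm))) t
  simpa [Fm.inst, Fm.subst, Tm.subst, addT_subst, Sub.cons] using this

/-- Induction on `s`. It turns the definition of `le` by truncated subtraction into a statement
about addition, from which antisymmetry and then the decidability of equality follow. -/
theorem Prf.add_sub_of_le (s t : Tm Γ .nat) :
    Prf H (le s t ⟶' addT ⬝ s ⬝ (subT ⬝ t ⬝ s) ≐ t) := by
  have hz (t : Tm Γ .nat) : Prf H (addT ⬝ .zero ⬝ t ≐ t) := by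
    have := Prf.induct (H := H) (A := addT ⬝ .zero ⬝ v0 ≐ v0) (by simp [Fm.QF])
      (by
        simp only [Fm.inst, Fm.subst, Tm.subst, addT_subst, Sub.cons]
        exact Prf.add_zero _)
      (by
        simp only [Fm.subst, Tm.subst, addT_subst, Sub.cons]
        exact (Prf.add_succ _ _).trans (.congr₁ .succ .head)) t
    simpa only [Fm.inst, Fm.subst, Tm.subst, addT_subst, Sub.cons] using this
  have := Prf.induct (H := H)
    (A := le v0 t.wk ⟶' addT ⬝ v0 ⬝ (subT ⬝ t.wk ⬝ v0) ≐ t.wk) (by simp [Fm.QF, le])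
    (by
      simp only [Fm.inst, le, Fm.subst, Tm.subst, addT_subst, subT_subst, Tm.wk_subst_cons,
        Tm.subst_id, Sub.cons]
      exact .impI (Prf.weaken ((hz _).trans (Prf.sub_zero _))))
    (by
      simp only [le, Fm.subst, Tm.subst, addT_subst, subT_subst, Tm.wk_subst_cons, Sub.cons,
        ← Tm.wk_eq_subst]
      refine .impI ?_
      have ih := Prf.impE (H := (subT ⬝ (.succ ⬝ v0) ⬝ t.wk ≐ .zero) ::
        (subT ⬝ v0 ⬝ t.wk ≐ .zero ⟶' addT ⬝ v0 ⬝ (subT ⬝ t.wk ⬝ v0) ≐ t.wk) :: H.map Fm.wk)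
        Prf.head.weaken
        (((Prf.sub_eq_pred _ _).trans (.congr₁ predT .head)).trans .pred_zero)
      refine .orE (.zero_or_succ (subT ⬝ t.wk ⬝ v0)) (.botE ?_) ?_
      · have e : Prf ((subT ⬝ t.wk ⬝ v0 ≐ .zero) :: (subT ⬝ (.succ ⬝ v0) ⬝ t.wk ≐ .zero) ::
            (subT ⬝ v0 ⬝ t.wk ≐ .zero ⟶' addT ⬝ v0 ⬝ (subT ⬝ t.wk ⬝ v0) ≐ t.wk) ::
            H.map Fm.wk) (v0 ≐ t.wk) :=
          ((Prf.add_zero _).symm.trans (.congr₂ addT .rfl Prf.head.symm)).trans ih.weaken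
        -- If `t ∸ s = 0`, the induction hypothesis gives `s = t`, so `(s + 1) ∸ t` is `1`, against
        -- the assumption that it is `0`.
        refine .impE (.ax (.succ_ne_zero .zero)) ?_
        exact ((Prf.succ_sub_self v0).symm.trans (.congr₂ subT .rfl e)).trans Prf.head.weaken
      · refine Prf.trans ?_ ih.weaken
        refine (Prf.succ_add _ _).trans ((Prf.add_succ _ _).symm.trans ?_)
        exact .congr₂ addT .rfl
          ((Prf.congr₁ .succ (.sub_succ _ _)).trans Prf.head.symm)) s
  simpa [Fm.inst, le, Fm.subst, Tm.subst, addT_subst, subT_subst, Sub.cons] using this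

theorem Prf.le_antisymm {s t : Tm Γ .nat} (h : Prf H (le s t)) (h' : Prf H (le t s)) :
    Prf H (s ≐ t) :=
  ((Prf.add_zero _).symm.trans (.congr₂ addT .rfl (Prf.symm h'))).trans
    (.impE (.add_sub_of_le s t) h)

theorem Prf.eq_zero_or_ne (t : Tm Γ .nat) : Prf H (t ≐ .zero ⋎ (t ≐ .zero).neg) :=
  .orE (.zero_or_succ t) (.orI₁ .head)
    (.orI₂ (.impI (.impE (.ax (.succ_ne_zero (predT ⬝ t)))
      (Prf.head.weaken.symm.trans .head))))

/-- Both truncated differences are tested for zero. This is the last arithmetical fact needed before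
completeness, as it makes equations stable. -/
theorem Prf.eq_or_ne (s t : Tm Γ .nat) : Prf H (s ≐ t ⋎ (s ≐ t).neg) := by
  refine .orE (.eq_zero_or_ne (subT ⬝ s ⬝ t)) (.orE (.eq_zero_or_ne (subT ⬝ t ⬝ s)) ?_ ?_) ?_
  · exact .orI₁ (.le_antisymm Prf.head.weaken .head)
  · exact .orI₂ (.impI (.impE Prf.head.weaken
      ((Prf.congr₂ subT .rfl .head).trans (.sub_self t))))
  · exact .orI₂ (.impI (.impE Prf.head.weaken
      ((Prf.congr₂ subT .head .rfl).trans (.sub_self t))))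

end Arithmetic

/-! ### The negative fragment -/

/-- Formulas without `∨` and `∃`. -/
def Fm.Neg : {Γ : Ctx} → Fm Γ → Prop
  | _, .eq _ _ => True
  | _, .bot => True
  | _, .and A B => A.Neg ∧ B.Neg
  | _, .or _ _ => False
  | _, .imp A B => A.Neg ∧ B.Neg
  | _, .all _ A => A.Neg
  | _, .ex _ _ => False

theorem Fm.Neg.subst {Γ Δ : Ctx} {A : Fm Γ} (h : A.Neg) (θ : Sub Γ Δ) : (A.subst θ).Neg := by
  induction A generalizing Δ with
  | eq s t => trivial
  | bot => trivial
  | and A B hA hB => exact ⟨hA h.1 θ, hB h.2 θ⟩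
  | or A B => exact h.elim
  | imp A B hA hB => exact ⟨hA h.1 θ, hB h.2 θ⟩
  | all σ A hA => exact hA h _
  | ex σ A => exact h.elim

theorem eqAt_neg {Γ : Ctx} (τ : Ty) (s t : Tm Γ τ) : (eqAt τ s t).Neg := by
  induction τ generalizing Γ with
  | nat => trivial
  | arr ρ τ _ ih => exact ih _ _

/-- Negative formulas are stable under double negation. -/
theorem Prf.stable {Γ : Ctx} {H : List (Fm Γ)} {A : Fm Γ} (hA : A.Neg) (h : Prf H A.neg.neg) :
    Prf H A := by
  induction A with
  -- The only case that depends on the theory: equality of type `0` is decidable.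
  | eq s t => exact .orE (.eq_or_ne s t) .head (.botE (.impE h.weaken .head))
  | bot => exact .impE h (.impI .head)
  | and A B ihA ihB =>
    refine .andI (ihA hA.1 (.impI (.impE h.weaken (.impI ?_))))
      (ihB hA.2 (.impI (.impE h.weaken (.impI ?_))))
    · exact .impE Prf.head.weaken (.andE₁ .head)
    · exact .impE Prf.head.weaken (.andE₂ .head)
  | or A B => exact hA.elim
  | imp A B ihA ihB =>
    refine .impI (ihB hA.2 (.impI (.impE h.weaken.weaken (.impI ?_))))
    exact .impE Prf.head.weaken (.impE .head Prf.head.weaken.weaken)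
  | all σ A ih =>
    refine .allI (ih hA (.impI (.impE h.wk.weaken (.impI ?_))))
    refine .impE Prf.head.weaken ?_
    have := Prf.allE (H := (Fm.all σ A).wk :: A.neg :: H.map Fm.wk) (.var .z) Prf.head
    rwa [Fm.lift_shift_inst_var] at this
  | ex σ A => exact hA.elim

/-! ### Interpretations and models -/

/-- An interpretation of the language of terms. -/
structure Interp where
  D : Ty → Type
  app : {ρ τ : Ty} → D (ρ ⇒ τ) → D ρ → D τ
  zero : D .nat
  succ : D (.nat ⇒ .nat)
  K (ρ τ : Ty) : D (ρ ⇒ τ ⇒ ρ)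
  S (δ ρ τ : Ty) : D ((δ ⇒ ρ ⇒ τ) ⇒ (δ ⇒ ρ) ⇒ δ ⇒ τ)
  R : D (.nat ⇒ .nat ⇒ (.nat ⇒ .nat ⇒ .nat) ⇒ .nat)

/-- Assignments of values to the variables of a context. -/
abbrev Env (M : Interp) (Γ : Ctx) : Type := ∀ τ : Ty, Var Γ τ → M.D τ

def Env.nil (M : Interp) : Env M [] := fun _ x => nomatch x

def Env.cons {M : Interp} {Γ : Ctx} {σ : Ty} (d : M.D σ) (e : Env M Γ) : Env M (σ :: Γ)
  | _, .z => d
  | _, .s x => e _ x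

theorem Env.ext_cons {M : Interp} {Γ : Ctx} {σ : Ty} {e e' : Env M (σ :: Γ)}
    (h0 : e _ .z = e' _ .z) (hs : ∀ τ (x : Var Γ τ), e _ x.s = e' _ x.s) : e = e' := by
  funext τ x
  cases x with
  | z => exact h0
  | s x => exact hs _ x

def Tm.eval {M : Interp} {Γ : Ctx} (e : Env M Γ) : {τ : Ty} → Tm Γ τ → M.D τ
  | _, .var x => e _ x
  | _, .zero => M.zero
  | _, .succ => M.succ
  | _, .K ρ τ => M.K ρ τ
  | _, .S δ ρ τ => M.S δ ρ τ
  | _, .R => M.R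
  | _, .app f a => M.app (f.eval e) (a.eval e)

def Fm.eval {M : Interp} : {Γ : Ctx} → Env M Γ → Fm Γ → Prop
  | _, e, .eq s t => s.eval e = t.eval e
  | _, _, .bot => False
  | _, e, .and A B => A.eval e ∧ B.eval e
  | _, e, .or A B => A.eval e ∨ B.eval e
  | _, e, .imp A B => A.eval e → B.eval e
  | _, e, .all σ A => ∀ d : M.D σ, A.eval (Env.cons d e)
  | _, e, .ex σ A => ∃ d : M.D σ, A.eval (Env.cons d e)

/-- The assignment obtained by evaluating a substitution. -/
def Sub.eval {M : Interp} {Γ Δ : Ctx} (θ : Sub Γ Δ) (e : Env M Δ) : Env M Γ :=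
  fun _ x => (θ _ x).eval e

section Eval

variable {M : Interp} {Γ Δ : Ctx}

theorem Tm.eval_subst (θ : Sub Γ Δ) (e : Env M Δ) {τ : Ty} (t : Tm Γ τ) :
    (t.subst θ).eval e = t.eval (θ.eval e) := by
  induction t with
  | app f a hf ha => simp [Tm.subst, Tm.eval, hf, ha]
  | _ => rfl

theorem Sub.eval_cons {σ : Ty} (t : Tm Δ σ) (θ : Sub Γ Δ) (e : Env M Δ) :
    (Sub.cons t θ).eval e = Env.cons (t.eval e) (θ.eval e) :=
  Env.ext_cons rfl fun _ _ => rfl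

theorem Sub.eval_id (e : Env M Γ) : (Sub.id Γ).eval e = e := rfl

theorem Sub.eval_wk {σ : Ty} (θ : Sub Γ Δ) (d : M.D σ) (e : Env M Δ) :
    (θ.wk σ).eval (Env.cons d e) = θ.eval e := by
  funext τ x
  change ((θ _ x).wk).eval _ = _
  rw [Tm.wk_eq_subst, Tm.eval_subst]
  rfl

theorem Sub.eval_lift {σ : Ty} (θ : Sub Γ Δ) (d : M.D σ) (e : Env M Δ) :
    (θ.lift σ).eval (Env.cons d e) = Env.cons d (θ.eval e) := by
  rw [Sub.lift, Sub.eval_cons, Sub.eval_wk]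
  rfl

theorem Tm.eval_wk {σ τ : Ty} (t : Tm Γ τ) (d : M.D σ) (e : Env M Γ) :
    t.wk.eval (Env.cons d e) = t.eval e := by
  rw [Tm.wk_eq_subst, Tm.eval_subst]
  rfl

theorem Tm.eval_closed {τ : Ty} (t : Tm [] τ) (e : Env M Γ) :
    t.closed.eval e = t.eval (Env.nil M) := by
  rw [Tm.closed_eq_subst, Tm.eval_subst]
  congr 1
  funext _ x
  cases x

theorem Fm.eval_subst (θ : Sub Γ Δ) (e : Env M Δ) (A : Fm Γ) :
    (A.subst θ).eval e ↔ A.eval (θ.eval e) := by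
  induction A generalizing Δ with
  | eq s t => simp [Fm.subst, Fm.eval, Tm.eval_subst]
  | bot => rfl
  | and A B hA hB => simp [Fm.subst, Fm.eval, hA, hB]
  | or A B hA hB => simp [Fm.subst, Fm.eval, hA, hB]
  | imp A B hA hB => simp [Fm.subst, Fm.eval, hA, hB]
  | all σ A hA => simp [Fm.subst, Fm.eval, hA, Sub.eval_lift]
  | ex σ A hA => simp [Fm.subst, Fm.eval, hA, Sub.eval_lift]

theorem Fm.eval_wk {σ : Ty} (A : Fm Γ) (d : M.D σ) (e : Env M Γ) :
    A.wk.eval (Env.cons d e) ↔ A.eval e := by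
  rw [Fm.wk, Fm.eval_subst]
  rfl

theorem Fm.eval_inst {σ : Ty} (A : Fm (σ :: Γ)) (t : Tm Γ σ) (e : Env M Γ) :
    (A.inst t).eval e ↔ A.eval (Env.cons (t.eval e) e) := by
  rw [Fm.inst, Fm.eval_subst, Sub.eval_cons]
  rfl

theorem Fm.eval_sentence (A : Fm []) (e : Env M Γ) :
    (A.subst (Sub.nil Γ)).eval e ↔ A.eval (Env.nil M) := by
  rw [Fm.eval_subst]
  have : (Sub.nil Γ).eval e = Env.nil M := by
    funext _ x
    cases x
  rw [this]

end Eval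

/-- An extensional interpretation in which all provable negative sentences are true. -/
structure Model extends Interp where
  ext : ∀ {ρ τ : Ty} (f g : D (ρ ⇒ τ)), (∀ x, app f x = app g x) → f = g
  sound : ∀ {A : Fm []}, A.Neg → Provable A → A.eval (Env.nil toInterp)

/-! ### Countability of the syntax -/

def Ty.code : Ty → ℕ
  | .nat => 0
  | .arr ρ τ => Nat.pair ρ.code τ.code + 1

theorem Ty.code_injective : Function.Injective Ty.code := by
  intro σ
  induction σ with
  | nat => intro τ h; cases τ <;> simp_all [Ty.code]
  | arr a b iha ihb =>
    intro τ h
    cases τ with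
    | nat => simp [Ty.code] at h
    | arr c d =>
      simp only [Ty.code, Nat.add_right_cancel_iff, Nat.pair_eq_pair] at h
      rw [iha h.1, ihb h.2]

instance : Countable Ty := Ty.code_injective.countable

instance : Nonempty Ty := ⟨.nat⟩

def Var.code : {Γ : Ctx} → {τ : Ty} → Var Γ τ → ℕ
  | _, _, .z => 0
  | _, _, .s x => x.code + 1

/-- The code is a bare position, but the context determines the type at each position; hence the
equality of dependent pairs. -/
theorem Var.code_injective {Γ : Ctx} {σ τ : Ty} (x : Var Γ σ) (y : Var Γ τ)
    (h : x.code = y.code) : (⟨σ, x⟩ : Σ τ, Var Γ τ) = ⟨τ, y⟩ := by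
  induction x with
  | z => cases y <;> simp_all [Var.code]
  | s x ih =>
    cases y with
    | z => simp [Var.code] at h
    | s y =>
      have := ih y (by simpa [Var.code] using h)
      cases this
      rfl

def Tm.code {Γ : Ctx} : {τ : Ty} → Tm Γ τ → ℕ
  | _, .var x => Nat.pair 0 x.code
  | _, .zero => Nat.pair 1 0
  | _, .succ => Nat.pair 2 0
  | _, .K ρ τ => Nat.pair 3 (Nat.pair ρ.code τ.code)
  | _, .S δ ρ τ => Nat.pair 4 (Nat.pair δ.code (Nat.pair ρ.code τ.code))
  | _, .R => Nat.pair 5 0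
  | _, .app f a => Nat.pair 6 (Nat.pair f.code a.code)

/-- The argument type of an application is not coded. It is recovered because the induction covers
terms of different types and yields the equality of the types as well. -/
theorem Tm.code_injective {Γ : Ctx} {σ τ : Ty} (s : Tm Γ σ) (t : Tm Γ τ)
    (h : s.code = t.code) : (⟨σ, s⟩ : Σ τ, Tm Γ τ) = ⟨τ, t⟩ := by
  induction s generalizing τ with
  | var x =>
    cases t <;> simp [Tm.code, Nat.pair_eq_pair] at h
    cases Var.code_injective _ _ h
    rfl
  | zero => cases t <;> simp [Tm.code, Nat.pair_eq_pair] at h; rfl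
  | succ => cases t <;> simp [Tm.code, Nat.pair_eq_pair] at h; rfl
  | K ρ τ =>
    cases t <;> simp [Tm.code, Nat.pair_eq_pair] at h
    cases Ty.code_injective h.1
    cases Ty.code_injective h.2
    rfl
  | S δ ρ τ =>
    cases t <;> simp [Tm.code, Nat.pair_eq_pair] at h
    cases Ty.code_injective h.1
    cases Ty.code_injective h.2.1
    cases Ty.code_injective h.2.2
    rfl
  | R => cases t <;> simp [Tm.code, Nat.pair_eq_pair] at h; rfl
  | app f a hf ha =>
    cases t <;> simp [Tm.code, Nat.pair_eq_pair] at h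
    cases hf _ h.1
    cases ha _ h.2
    rfl

def Fm.code : {Γ : Ctx} → Fm Γ → ℕ
  | _, .eq s t => Nat.pair 0 (Nat.pair s.code t.code)
  | _, .bot => Nat.pair 1 0
  | _, .and A B => Nat.pair 2 (Nat.pair A.code B.code)
  | _, .or A B => Nat.pair 3 (Nat.pair A.code B.code)
  | _, .imp A B => Nat.pair 4 (Nat.pair A.code B.code)
  | _, .all σ A => Nat.pair 5 (Nat.pair σ.code A.code)
  | _, .ex σ A => Nat.pair 6 (Nat.pair σ.code A.code)

theorem Fm.code_injective {Γ : Ctx} : Function.Injective (Fm.code (Γ := Γ)) := by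
  intro A
  induction A with
  | eq s t =>
    intro B h
    cases B <;> simp [Fm.code, Nat.pair_eq_pair] at h
    cases Tm.code_injective _ _ h.1
    cases Tm.code_injective _ _ h.2
    rfl
  | bot => intro B h; cases B <;> simp [Fm.code, Nat.pair_eq_pair] at h; rfl
  | and A A' ih ih' | or A A' ih ih' | imp A A' ih ih' =>
    intro B h
    cases B <;> simp [Fm.code, Nat.pair_eq_pair] at h
    cases ih h.1
    cases ih' h.2
    rfl
  | all σ A ih | ex σ A ih =>
    intro B h
    cases B <;> simp [Fm.code, Nat.pair_eq_pair] at h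
    cases Ty.code_injective h.1
    cases ih h.2
    rfl

instance {Γ : Ctx} : Countable (Fm Γ) := Fm.code_injective.countable

/-! ### Henkin chains -/

/-- The context `Γ` extended by the first `n` types of a sequence. -/
def ctxSeq (Γ : Ctx) (σ : ℕ → Ty) : ℕ → Ctx
  | 0 => Γ
  | n + 1 => σ n :: ctxSeq Γ σ n

/-- The weakening between two stages of a sequence of contexts. -/
def up {Γ : Ctx} {σ : ℕ → Ty} {n N : ℕ} (h : n ≤ N) : Sub (ctxSeq Γ σ n) (ctxSeq Γ σ N) :=
  Nat.leRecOn (C := fun k => Sub (ctxSeq Γ σ n) (ctxSeq Γ σ k)) h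
    (fun {k} θ => θ.wk (σ k)) (Sub.id _)

section Up

variable {Γ : Ctx} {σ : ℕ → Ty}

theorem up_self (n : ℕ) : up (Γ := Γ) (σ := σ) (le_refl n) = Sub.id _ :=
  Nat.leRecOn_self _

theorem up_succ {n N : ℕ} (h : n ≤ N) (h' : n ≤ N + 1) :
    up (Γ := Γ) (σ := σ) h' = (up h).wk (σ N) :=
  Nat.leRecOn_succ h _

theorem up_comp_up {n m N : ℕ} (h : n ≤ m) (h' : m ≤ N) :
    (up (Γ := Γ) (σ := σ) h).comp (up h') = up (h.trans h') := by
  induction N, h' using Nat.le_induction with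
  | base => rw [up_self, Sub.comp_id]
  | succ N hN ih =>
    rw [up_succ hN, up_succ (h.trans hN)]
    exact (Sub.comp_wk _ _).trans (congrArg (Sub.wk (σ N)) ih)

end Up

/-- A chain of consistent sets of hypotheses that decides every negative formula and provides
a counterexample to every refuted universal formula. -/
structure Chain (Γ : Ctx) where
  σ : ℕ → Ty
  H : ∀ n, List (Fm (ctxSeq Γ σ n))
  mono : ∀ n, (H n).map Fm.wk ⊆ H (n + 1)
  consistent : ∀ n, ¬ Prf (H n) .bot
  decides : ∀ (n : ℕ) (A : Fm (ctxSeq Γ σ n)), A.Neg → ∃ (N : ℕ) (h : n ≤ N),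
    Prf (H N) (A.subst (up h)) ∨ Prf (H N) (A.subst (up h)).neg
  witness : ∀ (n : ℕ) (τ : Ty) (B : Fm (τ :: ctxSeq Γ σ n)), B.Neg → ∃ (N : ℕ) (h : n ≤ N),
    Prf (H N) ((Fm.all τ B).subst (up h)) ∨
      ∃ t, Prf (H N) (B.subst (Sub.cons t (up h))).neg

/-- A closed term of every type. -/
def Tm.default {Γ : Ctx} : (τ : Ty) → Tm Γ τ
  | .nat => .zero
  | .arr ρ τ => .K τ ρ ⬝ Tm.default τ

/-- Every type contains a closed term, so a fresh variable can be instantiated and adds no strength.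
-/
theorem Prf.bot_of_wk {Γ : Ctx} {σ : Ty} {H : List (Fm Γ)}
    (h : Prf (H.map (Fm.wk (σ := σ))) .bot) : Prf H .bot :=
  Prf.allE (Tm.default σ) (.allI h)

/-- If `A` is consistent with `H`, it is added. Otherwise `¬A` is derivable, and if `A` is `∀ B` the
fresh variable is made a counterexample by adding `¬B`. Were this inconsistent, `¬¬B` would be
derivable for a generic variable, hence `B` by stability, hence `∀ B`, against `¬A`. -/
theorem exists_chain_step {Γ : Ctx} (σ : Ty) {H : List (Fm Γ)} (hH : ¬ Prf H .bot) {A : Fm Γ}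
    (hA : A.Neg) : ∃ H' : List (Fm (σ :: Γ)), H.map Fm.wk ⊆ H' ∧ ¬ Prf H' .bot ∧
      (Prf H' A.wk ∨ Prf H' A.neg.wk ∧ ∀ B, A = .all σ B → Prf H' B.neg) := by
  by_cases hc : Prf (A :: H) .bot
  · by_cases hB : ∃ B, A = .all σ B
    · obtain ⟨B, rfl⟩ := hB
      refine ⟨B.neg :: H.map Fm.wk, List.subset_cons_self _ _, fun h => hH ?_, .inr ⟨?_, ?_⟩⟩
      · exact .impE (.impI hc) (.allI (.stable hA (.impI h)))
      · exact Prf.weaken (Prf.wk (.impI hc))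
      · intro B' hB'
        cases hB'
        exact .head
    · refine ⟨H.map Fm.wk, List.Subset.refl _, fun h => hH h.bot_of_wk,
        .inr ⟨Prf.wk (.impI hc), fun B hB' => (hB ⟨B, hB'⟩).elim⟩⟩
  · exact ⟨(A :: H).map Fm.wk, List.map_subset _ (List.subset_cons_self _ _),
      fun h => hc h.bot_of_wk, .inl .head⟩

/-- The types of the fresh variables are fixed beforehand, so that the formulas of all stages form
one countable set. Each formula is then met at a later stage whose fresh variable has any prescribed
type. -/
theorem exists_chain {Γ : Ctx} {H₀ : List (Fm Γ)} (hH₀ : ¬ Prf H₀ .bot) :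
    ∃ C : Chain Γ, C.H 0 = H₀ := by
  classical
  obtain ⟨eT, heT⟩ := exists_surjective_nat Ty
  let σ : ℕ → Ty := fun n => eT n.unpair.1
  have : Nonempty (Σ m, Fm (ctxSeq Γ σ m)) := ⟨⟨0, .bot⟩⟩
  obtain ⟨eF, heF⟩ := exists_surjective_nat (Σ m, Fm (ctxSeq Γ σ m))
  -- A formula that is not negative, or not yet available at stage `n`, is replaced by the harmless
  -- negative formula `⊥`.
  let pick (p : Σ m, Fm (ctxSeq Γ σ m)) (n : ℕ) : Fm (ctxSeq Γ σ n) :=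
    if h : p.1 ≤ n ∧ p.2.Neg then p.2.subst (up h.1) else .bot
  have hpick (p) (n) : (pick p n).Neg := by
    by_cases h : p.1 ≤ n ∧ p.2.Neg
    · simp only [pick, dif_pos h]; exact h.2.subst _
    · simp only [pick, dif_neg h]; trivial
  let task (n : ℕ) := pick (eF n.unpair.2.unpair.1) n
  let HS : ∀ n, {H : List (Fm (ctxSeq Γ σ n)) // ¬ Prf H .bot} := fun n =>
    Nat.rec ⟨H₀, hH₀⟩ (fun n H =>
      ⟨(exists_chain_step (σ n) H.2 (hpick (eF n.unpair.2.unpair.1) n)).choose,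
        (exists_chain_step (σ n) H.2 (hpick (eF n.unpair.2.unpair.1) n)).choose_spec.2.1⟩) n
  have hstep (n : ℕ) := (exists_chain_step (σ n) (HS n).2
    (hpick (eF n.unpair.2.unpair.1) n)).choose_spec
  have stage (τ : Ty) (n : ℕ) (A : Fm (ctxSeq Γ σ n)) (hA : A.Neg) :
      ∃ N, ∃ h : n ≤ N, σ N = τ ∧ task N = A.subst (up h) := by
    obtain ⟨t, ht⟩ := heT τ
    obtain ⟨i, hi⟩ := heF ⟨n, A⟩
    -- The last component of the code is padding: it ensures that the stage is at least `n`.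
    have hN : n ≤ Nat.pair t (Nat.pair i n) :=
      (Nat.right_le_pair i n).trans (Nat.right_le_pair t _)
    refine ⟨Nat.pair t (Nat.pair i n), hN, by simp [σ, ht], ?_⟩
    have hp : eF (Nat.pair t (Nat.pair i n)).unpair.2.unpair.1 = ⟨n, A⟩ := by simp [hi]
    have ht : task (Nat.pair t (Nat.pair i n)) = pick ⟨n, A⟩ _ := by simp only [task, hp]
    rw [ht]
    exact dif_pos ⟨hN, hA⟩
  have hup {n N : ℕ} (h : n ≤ N) (A : Fm (ctxSeq Γ σ n)) :
      A.subst (up (h.trans N.le_succ)) = (A.subst (up h)).wk := by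
    rw [up_succ h, Fm.wk, Fm.subst_subst]
    exact congrArg (Fm.subst · A) (Sub.wk_eq_comp _ _)
  refine ⟨⟨σ, fun n => (HS n).1, fun n => (hstep n).1, fun n => (HS n).2, ?_, ?_⟩, rfl⟩
  · intro n A hA
    obtain ⟨N, h, -, hN⟩ := stage .nat n A hA
    refine ⟨N + 1, h.trans N.le_succ, ?_⟩
    rw [hup h, ← hN]
    exact (hstep N).2.2.imp id fun h => h.1
  · intro n τ B hB
    obtain ⟨N, h, rfl, hN⟩ := stage τ n (.all τ B) hB
    refine ⟨N + 1, h.trans N.le_succ, ?_⟩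
    rw [hup h, ← hN]
    refine (hstep N).2.2.imp id fun h' => ⟨.var .z, ?_⟩
    rw [up_succ h]
    exact h'.2 _ hN

/-! ### The term model of a Henkin chain -/

namespace Chain

variable {Γ : Ctx} (C : Chain Γ)

/-- The context of stage `n`. -/
abbrev ctx (n : ℕ) : Ctx := ctxSeq Γ C.σ n

/-- `A`, a formula of stage `n`, is derivable at some later stage. -/
def Th (n : ℕ) (A : Fm (C.ctx n)) : Prop :=
  ∃ (N : ℕ) (h : n ≤ N), Prf (C.H N) (A.subst (up h))

variable {C}

theorem prf_up {n N : ℕ} (h : n ≤ N) {A : Fm (C.ctx n)} (hA : Prf (C.H n) A) :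
    Prf (C.H N) (A.subst (up h)) := by
  induction N, h using Nat.le_induction with
  | base => rwa [up_self, Fm.subst_id]
  | succ N hN ih =>
    have := (ih.wk (σ := C.σ N)).mono (C.mono N)
    rw [Fm.wk, Fm.subst_subst] at this
    rw [up_succ hN]
    exact (congrArg (Fm.subst · A) (Sub.wk_eq_comp (C.σ N) (up hN))) ▸ this

theorem prf_of_le {n N N' : ℕ} (h : n ≤ N) (h' : N ≤ N') {A : Fm (C.ctx n)}
    (hA : Prf (C.H N) (A.subst (up h))) : Prf (C.H N') (A.subst (up (h.trans h'))) := by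
  rw [← up_comp_up h h', ← Fm.subst_subst]
  exact prf_up h' hA

theorem Th.of_prf {n : ℕ} {A : Fm (C.ctx n)} (h : Prf (C.H n) A) : C.Th n A :=
  ⟨n, le_refl n, by rwa [up_self, Fm.subst_id]⟩

theorem Th.mp {n : ℕ} {A B : Fm (C.ctx n)} (h : C.Th n (A ⟶' B)) (hA : C.Th n A) : C.Th n B := by
  obtain ⟨N, hN, h⟩ := h
  obtain ⟨N', hN', hA⟩ := hA
  exact ⟨max N N', hN.trans (le_max_left _ _),
    .impE (prf_of_le hN (le_max_left _ _) h) (prf_of_le hN' (le_max_right _ _) hA)⟩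

theorem Th.map {n : ℕ} {A B : Fm (C.ctx n)} (hA : C.Th n A) (h : Prf [A] B) : C.Th n B :=
  Th.mp (.of_prf (Prf.mono (.impI h) (List.nil_subset _))) hA

theorem Th.map₂ {n : ℕ} {A B D : Fm (C.ctx n)} (hA : C.Th n A) (hB : C.Th n B)
    (h : Prf [B, A] D) : C.Th n D :=
  Th.mp (hA.map (.impI h)) hB

theorem not_th_bot {n : ℕ} : ¬ C.Th n .bot := fun ⟨N, _, h⟩ => C.consistent N h

theorem th_up_iff {n N : ℕ} (h : n ≤ N) {A : Fm (C.ctx n)} :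
    C.Th N (A.subst (up h)) ↔ C.Th n A := by
  constructor
  · rintro ⟨N', h', hA⟩
    rw [Fm.subst_subst, up_comp_up] at hA
    exact ⟨N', _, hA⟩
  · rintro ⟨N', h', hA⟩
    refine ⟨max N N', le_max_left _ _, ?_⟩
    rw [Fm.subst_subst, up_comp_up]
    exact prf_of_le h' (le_max_right _ _) hA

theorem th_or_th_neg {n : ℕ} {A : Fm (C.ctx n)} (hA : A.Neg) : C.Th n A ∨ C.Th n A.neg := by
  obtain ⟨N, h, h' | h'⟩ := C.decides n A hA
  · exact .inl ⟨N, h, h'⟩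
  · exact .inr ⟨N, h, h'⟩

theorem th_all_or {n : ℕ} {τ : Ty} {B : Fm (τ :: C.ctx n)} (hB : B.Neg) :
    C.Th n (.all τ B) ∨
      ∃ (N : ℕ) (h : n ≤ N) (t : Tm (C.ctx N) τ), C.Th N (B.subst (Sub.cons t (up h))).neg := by
  obtain ⟨N, h, h' | ⟨t, h'⟩⟩ := C.witness n τ B hB
  · exact .inl ⟨N, h, h'⟩
  · exact .inr ⟨N, h, t, .of_prf h'⟩

variable (C)

/-- Terms of all stages, related when they are provably equal at some stage. -/
def setoid (τ : Ty) : Setoid (Σ n, Tm (C.ctx n) τ) where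
  r s t := ∃ (N : ℕ) (h : s.1 ≤ N) (h' : t.1 ≤ N),
    C.Th N (eqAt τ (s.2.subst (up h)) (t.2.subst (up h')))
  iseqv := by
    have lift {n N N' : ℕ} (h : n ≤ N) (h' : N ≤ N') (t : Tm (C.ctx n) τ) :
        (t.subst (up h)).subst (up h') = t.subst (up (h.trans h')) := by
      rw [Tm.subst_subst, up_comp_up]
    refine ⟨fun s => ⟨s.1, le_rfl, le_rfl, .of_prf (.eqAt_refl _)⟩, ?_, ?_⟩
    · rintro s t ⟨N, h, h', e⟩
      exact ⟨N, h', h, e.map Prf.head.eqAt_symm⟩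
    · rintro s t u ⟨N, h₁, h₂, e⟩ ⟨N', h₃, h₄, e'⟩
      refine ⟨max N N', h₁.trans (le_max_left _ _), h₄.trans (le_max_right _ _), ?_⟩
      rw [← th_up_iff (le_max_left N N'), eqAt_subst, lift, lift] at e
      rw [← th_up_iff (le_max_right N N'), eqAt_subst, lift, lift] at e'
      exact e.map₂ e' (Prf.head.weaken.eqAt_trans .head)

/-- The elements of the term model. -/
def Carrier (τ : Ty) : Type := Quotient (C.setoid τ)

/-- The element named by a term of stage `n`. -/
def el (n : ℕ) {τ : Ty} (t : Tm (C.ctx n) τ) : C.Carrier τ := Quotient.mk (C.setoid τ) ⟨n, t⟩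

variable {C}

theorem el_up {n N : ℕ} (h : n ≤ N) {τ : Ty} (t : Tm (C.ctx n) τ) :
    C.el N (t.subst (up h)) = C.el n t :=
  Quotient.sound ⟨N, le_rfl, h, by
    rw [up_self, Tm.subst_id]
    exact .of_prf (.eqAt_refl _)⟩

theorem el_eq_el {n : ℕ} {τ : Ty} {s t : Tm (C.ctx n) τ} :
    C.el n s = C.el n t ↔ C.Th n (eqAt τ s t) := by
  constructor
  · intro h
    obtain ⟨N, h, _, e⟩ := Quotient.exact h
    rwa [← eqAt_subst, th_up_iff] at e
  · intro h
    exact Quotient.sound ⟨n, le_rfl, le_rfl, by simpa only [up_self, Tm.subst_id] using h⟩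

theorem exists_el {τ : Ty} (d : C.Carrier τ) (n : ℕ) :
    ∃ (N : ℕ) (_ : n ≤ N) (t : Tm (C.ctx N) τ), d = C.el N t := by
  obtain ⟨⟨m, t⟩, rfl⟩ := Quotient.exists_rep d
  exact ⟨max n m, le_max_left _ _, t.subst (up (le_max_right _ _)), (el_up _ t).symm⟩

theorem exists_el₂ {σ τ : Ty} (d : C.Carrier σ) (d' : C.Carrier τ) (n : ℕ) :
    ∃ (N : ℕ) (_ : n ≤ N) (s : Tm (C.ctx N) σ) (t : Tm (C.ctx N) τ),
      d = C.el N s ∧ d' = C.el N t := by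
  obtain ⟨N, hN, s, rfl⟩ := exists_el d n
  obtain ⟨N', hN', t, rfl⟩ := exists_el d' N
  exact ⟨N', hN.trans hN', s.subst (up hN'), t, (el_up _ s).symm, rfl⟩

variable (C)

/-- Application in the term model. -/
def capp {ρ τ : Ty} : C.Carrier (ρ ⇒ τ) → C.Carrier ρ → C.Carrier τ :=
  Quotient.lift₂
    (fun f a => C.el (max f.1 a.1)
      (f.2.subst (up (le_max_left _ _)) ⬝ a.2.subst (up (le_max_right _ _))))
    (by
      rintro ⟨m, f⟩ ⟨n, a⟩ ⟨m', f'⟩ ⟨n', a'⟩ hf ha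
      have hf : C.el m f = C.el m' f' := Quotient.sound hf
      have ha : C.el n a = C.el n' a' := Quotient.sound ha
      let N := max (max m n) (max m' n')
      have h₁ : max m n ≤ N := le_max_left _ _
      have h₂ : max m' n' ≤ N := le_max_right _ _
      rw [← el_up h₁, ← el_up h₂, el_eq_el]
      simp only [Tm.subst, Tm.subst_subst, up_comp_up]
      rw [← el_up ((le_max_left m n).trans h₁), ← el_up ((le_max_left m' n').trans h₂),
        el_eq_el] at hf
      rw [← el_up ((le_max_right m n).trans h₁), ← el_up ((le_max_right m' n').trans h₂),
        el_eq_el] at ha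
      exact hf.map₂ ha (Prf.head.weaken.eqAt_congr .head))

variable {C}

theorem capp_el {n : ℕ} {ρ τ : Ty} (f : Tm (C.ctx n) (ρ ⇒ τ)) (a : Tm (C.ctx n) ρ) :
    C.capp (C.el n f) (C.el n a) = C.el n (f ⬝ a) := by
  rw [← el_up (le_max_left n n) (f ⬝ a)]
  rfl

variable (C)

/-- The term model as an interpretation. -/
def interp : Interp where
  D := C.Carrier
  app := C.capp
  zero := C.el 0 .zero
  succ := C.el 0 .succ
  K ρ τ := C.el 0 (.K ρ τ)
  S δ ρ τ := C.el 0 (.S δ ρ τ)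
  R := C.el 0 .R

/-- The assignment given by a substitution into stage `n`. -/
def env {Δ : Ctx} {n : ℕ} (θ : Sub Δ (C.ctx n)) : Env C.interp Δ := fun _ x => C.el n (θ _ x)

variable {C}

theorem env_up {Δ : Ctx} {n N : ℕ} (h : n ≤ N) (θ : Sub Δ (C.ctx n)) :
    C.env (θ.comp (up h)) = C.env θ := by
  funext τ x
  exact el_up h _

theorem env_cons {Δ : Ctx} {n : ℕ} {σ : Ty} (t : Tm (C.ctx n) σ) (θ : Sub Δ (C.ctx n)) :
    C.env (Sub.cons t θ) = Env.cons (M := C.interp) (C.el n t) (C.env θ) :=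
  Env.ext_cons rfl fun _ _ => rfl

theorem eval_env {Δ : Ctx} {n : ℕ} (θ : Sub Δ (C.ctx n)) {τ : Ty} (t : Tm Δ τ) :
    t.eval (C.env θ) = C.el n (t.subst θ) := by
  induction t with
  | app f a hf ha =>
    rw [Tm.eval, hf, ha]
    exact capp_el _ _
  | var x => rfl
  | _ => exact (el_up (Nat.zero_le n) _).symm

/-- In the term model, truth is derivability at some stage. -/
theorem eval_iff_th {Δ : Ctx} {A : Fm Δ} (hA : A.Neg) {n : ℕ} (θ : Sub Δ (C.ctx n)) :
    A.eval (C.env θ) ↔ C.Th n (A.subst θ) := by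
  induction A generalizing n with
  | eq s t =>
    rw [Fm.eval, eval_env, eval_env]
    exact el_eq_el
  | bot => exact ⟨False.elim, not_th_bot⟩
  | and A B ihA ihB =>
    rw [Fm.eval, ihA hA.1, ihB hA.2]
    exact ⟨fun h => h.1.map₂ h.2 (.andI Prf.head.weaken .head),
      fun h => ⟨h.map (.andE₁ .head), h.map (.andE₂ .head)⟩⟩
  | or A B => exact hA.elim
  | imp A B ihA ihB =>
    rw [Fm.eval, ihA hA.1, ihB hA.2]
    refine ⟨fun h => ?_, fun h h' => h.mp h'⟩
    -- The chain decides `A`; if it refutes `A`, the implication is derivable for that reason.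
    rcases th_or_th_neg (hA.1.subst θ) with h' | h'
    · exact (h h').map (.impI Prf.head.weaken)
    · exact h'.map (.impI (.botE (.impE Prf.head.weaken .head)))
  | all σ A ih =>
    constructor
    · intro h
      -- A universal formula that is not derivable has a term as counterexample, and this term names
      -- an element of the model.
      refine (th_all_or (Fm.Neg.subst (A := A) hA (θ.lift σ))).resolve_right ?_
      rintro ⟨N, hN, t, ht⟩
      have := h (C.el N t)
      rw [← env_up hN, ← env_cons, ih hA] at this
      rw [Fm.subst_subst, Sub.lift_comp_cons] at ht
      exact not_th_bot (ht.mp this)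
    · intro h d
      obtain ⟨N, hN, t, rfl⟩ := exists_el d n
      rw [← env_up hN, ← env_cons, ih hA]
      rw [← th_up_iff hN, Fm.subst_subst] at h
      have := h.map (Prf.allE t .head)
      rwa [Fm.inst, Fm.subst_subst, Sub.lift_comp_cons, Sub.comp_id] at this
  | ex σ A => exact hA.elim

variable (C)

/-- The term model. -/
def model : Model where
  toInterp := C.interp
  ext := by
    intro ρ τ f g h
    obtain ⟨n, -, f, g, rfl, rfl⟩ := exists_el₂ (C := C) f g 0
    -- Equality at an arrow type is a negative universal formula, so a failure of it would be
    -- witnessed by a term.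
    refine el_eq_el.mpr ((th_all_or (eqAt_neg _ _ _)).resolve_right ?_)
    rintro ⟨N, hN, t, ht⟩
    have := h (C.el N t)
    rw [← el_up hN f, ← el_up hN g] at this
    have := el_eq_el.mp ((capp_el _ _).symm.trans (this.trans (capp_el _ _)))
    rw [eqAt_subst] at ht
    simp only [Tm.subst, Tm.wk_subst_cons] at ht
    exact not_th_bot (ht.mp this)
  sound := by
    intro A hA h
    have : Env.nil C.interp = C.env (Sub.nil (C.ctx 0)) := by
      funext _ x
      cases x
    rw [this, eval_iff_th hA]
    exact .of_prf (.of_sentence h)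

end Chain

/-- Completeness for the negative fragment: a negative formula that holds in every model in
which the negative hypotheses hold is derivable. -/
theorem complete {Γ : Ctx} {H : List (Fm Γ)} {A : Fm Γ} (hA : A.Neg)
    (h : ∀ (M : Model) (e : Env M.toInterp Γ), (∀ B ∈ H, B.Neg → B.eval e) → A.eval e) :
    Prf H A := by
  by_contra hc
  -- By stability, if `A` is not derivable then `¬A` is consistent with `H`.
  obtain ⟨C, hC⟩ := exists_chain (H₀ := A.neg :: H) fun h => hc (.stable hA (.impI h))
  have holds (B : Fm Γ) (hB : B ∈ A.neg :: H) (hn : B.Neg) :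
      B.eval (C.env (n := 0) (Sub.id Γ)) := by
    refine (Chain.eval_iff_th hn (n := 0) (Sub.id Γ)).mpr (.of_prf (.hyp ?_))
    rw [hC]
    exact (Fm.subst_id B).symm ▸ hB
  exact holds _ List.mem_cons_self ⟨hA, trivial⟩
    (h C.model _ fun B hB hn => holds B (List.mem_cons_of_mem _ hB) hn)

/-! ### Models satisfy the axioms -/

theorem eq_neg {Γ : Ctx} (s t : Tm Γ .nat) : (s ≐ t).Neg := trivial

namespace Model

variable (M : Model)

/-- Passing to the universal closure keeps a formula negative. Through this lemma the axioms and the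
arithmetic derived by hand become facts about the model. -/
theorem holds {Γ : Ctx} {A : Fm Γ} (hA : A.Neg) (h : Prf [] A) (e : Env M.toInterp Γ) :
    A.eval e := by
  induction Γ with
  | nil =>
    have : e = Env.nil M.toInterp := by
      funext _ x
      cases x
    exact this ▸ M.sound hA h
  | cons σ Γ ih =>
    have := ih (A := .all σ A) hA (.allI h) (fun _ x => e _ x.s) (e _ .z)
    have he : Env.cons (e _ .z) (fun _ x => e _ x.s) = e := Env.ext_cons rfl fun _ _ => rfl
    rwa [he] at this

variable {M}

/-- Extensionality of the model turns the pointwise equality of the language into identity of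
elements. -/
theorem eval_eqAt {Γ : Ctx} {τ : Ty} (s t : Tm Γ τ) (e : Env M.toInterp Γ) :
    (eqAt τ s t).eval e ↔ s.eval e = t.eval e := by
  induction τ generalizing Γ with
  | nat => rfl
  | arr ρ τ _ ih =>
    simp only [eqAt, Fm.eval, ih, Tm.eval, Tm.eval_wk]
    exact ⟨M.ext _ _, fun h x => by rw [h]⟩

variable (M)

theorem app_K {ρ τ : Ty} (x : M.D ρ) (y : M.D τ) : M.app (M.app (M.K ρ τ) x) y = x :=
  (eval_eqAt _ _ _).mp (M.holds (eqAt_neg _ _ _) (.ax (.K_eq (Γ := [τ, ρ]) v1 v0))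
    (Env.cons y (Env.cons x (Env.nil _))))

theorem app_S {δ ρ τ : Ty} (x : M.D (δ ⇒ ρ ⇒ τ)) (y : M.D (δ ⇒ ρ)) (z : M.D δ) :
    M.app (M.app (M.app (M.S δ ρ τ) x) y) z = M.app (M.app x z) (M.app y z) :=
  (eval_eqAt _ _ _).mp (M.holds (eqAt_neg _ _ _)
    (.ax (.S_eq (Γ := [δ, δ ⇒ ρ, δ ⇒ ρ ⇒ τ]) v2 v1 v0))
    (Env.cons z (Env.cons y (Env.cons x (Env.nil _)))))

theorem app_R_zero (y : M.D .nat) (z : M.D (.nat ⇒ .nat ⇒ .nat)) :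
    M.app (M.app (M.app M.R M.zero) y) z = y :=
  M.holds (A := .R ⬝ .zero ⬝ v1 ⬝ v0 ≐ v1) (eq_neg _ _) (.ax (.R_zero _ _))
    (Env.cons z (Env.cons y (Env.nil _)))

theorem app_R_succ (x y : M.D .nat) (z : M.D (.nat ⇒ .nat ⇒ .nat)) :
    M.app (M.app (M.app M.R (M.app M.succ x)) y) z =
      M.app (M.app z (M.app (M.app (M.app M.R x) y) z)) x :=
  M.holds (A := .R ⬝ (.succ ⬝ v2) ⬝ v1 ⬝ v0 ≐ v0 ⬝ (.R ⬝ v2 ⬝ v1 ⬝ v0) ⬝ v2) (eq_neg _ _)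
    (.ax (.R_succ _ _ _)) (Env.cons z (Env.cons y (Env.cons x (Env.nil _))))

variable {M}

/-- `β`-conversion in a model. -/
@[simp] theorem eval_lam {Γ : Ctx} {σ τ : Ty} (t : Tm (σ :: Γ) τ) (e : Env M.toInterp Γ)
    (d : M.D σ) : M.app (t.lam.eval e) d = t.eval (Env.cons d e) := by
  induction t with
  | var x =>
    cases x with
    | z => simp [Tm.lam, Tm.eval, app_S, app_K, Env.cons]
    | s x => simp [Tm.lam, Tm.eval, app_K, Env.cons]
  | app f a hf ha => simp [Tm.lam, Tm.eval, app_S, hf, ha]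
  | _ => simp [Tm.lam, Tm.eval, app_K]

/-! ### Arithmetic in a model -/

/-- The operations and relations are those computed by the terms of the language, so formulas
evaluate directly to statements in this notation. Their algebraic laws are proved later, by
induction in the model. -/
instance : Zero (M.D .nat) := ⟨M.zero⟩
instance : One (M.D .nat) := ⟨M.app M.succ M.zero⟩
instance : Add (M.D .nat) := ⟨fun x y => M.app (M.app (addT.eval (Env.nil _)) x) y⟩
instance : _root_.Sub (M.D .nat) := ⟨fun x y => M.app (M.app (subT.eval (Env.nil _)) x) y⟩
instance : LE (M.D .nat) := ⟨fun x y => x - y = 0⟩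
instance : LT (M.D .nat) := ⟨fun x y => x + 1 ≤ y⟩

section Eval

variable {Γ : Ctx} (e : Env M.toInterp Γ)

theorem eval_zero : (Tm.zero : Tm Γ .nat).eval e = 0 := rfl

theorem eval_addT (s t : Tm Γ .nat) : (addT ⬝ s ⬝ t).eval e = s.eval e + t.eval e := by
  have : (addT : Tm Γ _).eval e = addT.eval (Env.nil _) := by
    simp only [addT, Tm.lam, Tm.eval]
  simp only [Tm.eval, this]
  rfl

theorem eval_subT (s t : Tm Γ .nat) : (subT ⬝ s ⬝ t).eval e = s.eval e - t.eval e := by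
  have : (subT : Tm Γ _).eval e = subT.eval (Env.nil _) := by
    simp only [subT, predT, Tm.lam, Tm.eval]
  simp only [Tm.eval, this]
  rfl

end Eval

theorem add_zero' (x : M.D .nat) : x + 0 = x := by
  have := M.holds (A := addT ⬝ v0 ⬝ .zero ≐ v0) (eq_neg _ _) (.add_zero _) (Env.cons x (Env.nil _))
  simp only [Fm.eval, eval_addT] at this
  exact this

theorem add_succ' (x y : M.D .nat) : x + M.app M.succ y = M.app M.succ (x + y) := by
  have := M.holds (A := addT ⬝ v1 ⬝ (.succ ⬝ v0) ≐ .succ ⬝ (addT ⬝ v1 ⬝ v0)) (eq_neg _ _)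
    (.add_succ _ _) (Env.cons y (Env.cons x (Env.nil _)))
  have h := eval_addT (Env.cons y (Env.cons x (Env.nil M.toInterp)))
  rw [Fm.eval, h] at this
  exact this.trans (congrArg (M.app M.succ) (h _ _))

theorem succ_eq (x : M.D .nat) : M.app M.succ x = x + 1 := by
  have := add_succ' x M.zero
  rw [show x + M.zero = x from add_zero' x] at this
  exact this.symm

theorem eval_succ {Γ : Ctx} (e : Env M.toInterp Γ) (t : Tm Γ .nat) :
    (Tm.succ ⬝ t).eval e = t.eval e + 1 :=
  succ_eq _

theorem add_add_one (x y : M.D .nat) : x + (y + 1) = x + y + 1 := by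
  rw [← succ_eq, ← succ_eq, add_succ']

theorem eval_le {Γ : Ctx} (e : Env M.toInterp Γ) (s t : Tm Γ .nat) :
    (le s t).eval e ↔ s.eval e ≤ t.eval e := by
  rw [le, Fm.eval, eval_subT]
  rfl

theorem eval_lt {Γ : Ctx} (e : Env M.toInterp Γ) (s t : Tm Γ .nat) :
    (lt s t).eval e ↔ s.eval e < t.eval e := by
  rw [lt, eval_le, eval_succ]
  rfl

theorem le_def (x y : M.D .nat) : x ≤ y ↔ x - y = 0 := Iff.rfl

theorem lt_def (x y : M.D .nat) : x < y ↔ x + 1 ≤ y := Iff.rfl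

theorem sub_self' (x : M.D .nat) : x - x = 0 := by
  have := M.holds (A := subT ⬝ v0 ⬝ v0 ≐ .zero) (eq_neg _ _) (.sub_self _) (Env.cons x (Env.nil _))
  simp only [Fm.eval, eval_subT] at this
  exact this

theorem le_antisymm' {x y : M.D .nat} (h : x ≤ y) (h' : y ≤ x) : x = y := by
  have := M.holds (A := le v1 v0 ⟶' le v0 v1 ⟶' v1 ≐ v0) (by simp [Fm.Neg, le])
    (.impI (.impI (Prf.le_antisymm Prf.head.weaken .head))) (Env.cons y (Env.cons x (Env.nil _)))
  simp only [Fm.eval, eval_le] at this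
  exact this h h'

theorem add_sub_of_le' {x y : M.D .nat} (h : x ≤ y) : x + (y - x) = y := by
  have := M.holds (A := le v1 v0 ⟶' addT ⬝ v1 ⬝ (subT ⬝ v0 ⬝ v1) ≐ v0) (by simp [Fm.Neg, le])
    (.add_sub_of_le _ _) (Env.cons y (Env.cons x (Env.nil _)))
  simp only [Fm.eval, eval_le, eval_addT, eval_subT] at this
  exact this h

/-- The predecessor in a model. -/
abbrev pred (x : M.D .nat) : M.D .nat := M.app (predT.eval (Env.nil _)) x

theorem eval_predT {Γ : Ctx} (e : Env M.toInterp Γ) (t : Tm Γ .nat) :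
    (predT ⬝ t).eval e = pred (t.eval e) := by
  have : (predT : Tm Γ _).eval e = predT.eval (Env.nil _) := by
    simp only [predT, Tm.lam, Tm.eval]
  simp only [Tm.eval, this]

theorem pred_zero : pred (0 : M.D .nat) = 0 :=
  M.holds (A := predT ⬝ .zero ≐ .zero) (eq_neg _ _) .pred_zero (Env.nil _)

theorem pred_add_one (x : M.D .nat) : pred (x + 1) = x := by
  have := M.holds (A := predT ⬝ (.succ ⬝ v0) ≐ v0) (eq_neg _ _) (.pred_succ _)
    (Env.cons x (Env.nil _))
  rw [Fm.eval, eval_predT, eval_succ] at this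
  exact this

theorem sub_add_one (x y : M.D .nat) : x - (y + 1) = pred (x - y) := by
  have := M.holds (A := subT ⬝ v1 ⬝ (.succ ⬝ v0) ≐ predT ⬝ (subT ⬝ v1 ⬝ v0)) (eq_neg _ _)
    (.sub_succ _ _) (Env.cons y (Env.cons x (Env.nil _)))
  rw [Fm.eval, eval_predT, eval_subT, eval_subT, eval_succ] at this
  exact this

/-- A disjunction is not negative and does not transfer to a model. The implication `x ≠ 0 → x = S
(pred x)` does, and the cases are then split classically. -/
theorem eq_zero_or_eq_add_one (x : M.D .nat) : x = 0 ∨ ∃ y, x = y + 1 := by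
  have := M.holds (A := (v0 ≐ .zero).neg ⟶' v0 ≐ .succ ⬝ (predT ⬝ v0)) (by simp [Fm.Neg, Fm.neg])
    (.impI (.orE (.zero_or_succ v0) (.botE (.impE Prf.head.weaken .head)) .head))
    (Env.cons x (Env.nil _))
  by_cases h : x = 0
  · exact .inl h
  · exact .inr ⟨_, (this h).trans (succ_eq _)⟩

theorem add_one_ne_zero (x : M.D .nat) : x + 1 ≠ 0 := by
  have := M.holds (A := ((Tm.succ ⬝ v0) ≐ .zero).neg) (by simp [Fm.Neg, Fm.neg])
    (.ax (.succ_ne_zero _)) (Env.cons x (Env.nil _))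
  rw [← succ_eq]
  exact this

theorem add_one_inj {x y : M.D .nat} (h : x + 1 = y + 1) : x = y := by
  rw [← pred_add_one x, h, pred_add_one]

/-! ### Represented functions and decidable predicates -/

/-- Functions represented by an element of the model. -/
class Rep {σ τ : Ty} (F : M.D σ → M.D τ) : Prop where
  out : ∃ f : M.D (σ ⇒ τ), ∀ x, M.app f x = F x

/-- With the instances for constants and application, instance search performs the abstraction by
combinators. -/
instance {σ : Ty} : Rep (fun x : M.D σ => x) :=
  ⟨(Tm.lam v0).eval (Env.nil _), fun x => by simp [Tm.eval, Env.cons]⟩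

instance {σ : Ty} : Rep (id : M.D σ → M.D σ) := inferInstanceAs (Rep fun x => x)

instance {σ τ : Ty} (d : M.D τ) : Rep (fun _ : M.D σ => d) := ⟨M.app (M.K _ _) d, M.app_K d⟩

instance {σ τ : Ty} (f : M.D (σ ⇒ τ)) : Rep (M.app f) := ⟨f, fun _ => rfl⟩

instance {σ ρ τ : Ty} (F : M.D σ → M.D (ρ ⇒ τ)) (G : M.D σ → M.D ρ) [hF : Rep F] [hG : Rep G] :
    Rep fun x => M.app (F x) (G x) := by
  obtain ⟨f, hf⟩ := hF
  obtain ⟨g, hg⟩ := hG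
  exact ⟨M.app (M.app (M.S _ _ _) f) g, fun x => by rw [M.app_S, hf, hg]⟩

instance {σ : Ty} (F G : M.D σ → M.D .nat) [Rep F] [Rep G] : Rep fun x => F x + G x :=
  inferInstanceAs (Rep fun x => M.app (M.app (addT.eval (Env.nil _)) (F x)) (G x))

instance {σ : Ty} (F G : M.D σ → M.D .nat) [Rep F] [Rep G] : Rep fun x => F x - G x :=
  inferInstanceAs (Rep fun x => M.app (M.app (subT.eval (Env.nil _)) (F x)) (G x))

/-- Covers the η-reduced form of `fun y => x + y`; writing `id y` prevents the same contraction
here. -/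
instance (x : M.D .nat) : Rep (HAdd.hAdd x) := inferInstanceAs (Rep fun y => x + id y)

instance (x : M.D .nat) : Rep (HSub.hSub x) := inferInstanceAs (Rep fun y => x - id y)

/-- Predicates given by the zeros of a represented function. -/
class Dec (P : M.D .nat → Prop) : Prop where
  out : ∃ f : M.D .one, ∀ x, M.app f x = 0 ↔ P x

/-- `cond x y z` is `z` if `x = 0` and `y` otherwise. -/
abbrev cond (x y z : M.D .nat) : M.D .nat :=
  M.app (M.app (M.app M.R x) z) (M.app (M.K _ .nat) (M.app (M.K _ .nat) y))

theorem cond_zero (y z : M.D .nat) : cond 0 y z = z := M.app_R_zero _ _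

theorem cond_of_ne {x : M.D .nat} (h : x ≠ 0) (y z : M.D .nat) : cond x y z = y := by
  obtain ⟨x, rfl⟩ := (eq_zero_or_eq_add_one x).resolve_left h
  rw [cond, ← succ_eq, app_R_succ, app_K, app_K]

theorem dec_and {P Q : M.D .nat → Prop} (hP : Dec P) (hQ : Dec Q) : Dec fun x => P x ∧ Q x := by
  obtain ⟨f, hf⟩ := hP
  obtain ⟨g, hg⟩ := hQ
  obtain ⟨k, hk⟩ := (inferInstance : Rep fun x => cond (M.app f x) 1 (M.app g x))
  refine ⟨k, fun x => ?_⟩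
  rw [hk, ← hf, ← hg]
  by_cases h : M.app f x = 0
  · rw [h, cond_zero]; simp
  · rw [cond_of_ne h]
    simp only [h, false_and, iff_false]
    exact fun h => add_one_ne_zero (0 : M.D .nat) (by rw [← succ_eq]; exact h)

theorem dec_not {P : M.D .nat → Prop} (hP : Dec P) : Dec fun x => ¬ P x := by
  obtain ⟨f, hf⟩ := hP
  obtain ⟨k, hk⟩ := (inferInstance : Rep fun x => cond (M.app f x) 0 1)
  refine ⟨k, fun x => ?_⟩
  rw [hk, ← hf]
  by_cases h : M.app f x = 0
  · rw [h, cond_zero]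
    simp only [not_true_eq_false, iff_false]
    exact fun h => add_one_ne_zero (0 : M.D .nat) (by rw [← succ_eq]; exact h)
  · rw [cond_of_ne h]; simp [h]

instance {P Q : M.D .nat → Prop} [hP : Dec P] [hQ : Dec Q] : Dec fun x => P x ∧ Q x :=
  dec_and hP hQ

instance {P : M.D .nat → Prop} [hP : Dec P] : Dec fun x => ¬ P x := dec_not hP

instance {P Q : M.D .nat → Prop} [hP : Dec P] [hQ : Dec Q] : Dec fun x => P x → Q x := by
  obtain ⟨f, hf⟩ := dec_not (dec_and hP (dec_not hQ))
  exact ⟨f, fun x => (hf x).trans (by tauto)⟩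

instance {P Q : M.D .nat → Prop} [hP : Dec P] [hQ : Dec Q] : Dec fun x => P x ∨ Q x := by
  obtain ⟨f, hf⟩ := dec_not (dec_and (dec_not hP) (dec_not hQ))
  exact ⟨f, fun x => (hf x).trans (by tauto)⟩

instance (F G : M.D .nat → M.D .nat) [Rep F] [Rep G] : Dec fun x => F x ≤ G x := by
  obtain ⟨f, hf⟩ := (inferInstance : Rep fun x => F x - G x)
  exact ⟨f, fun x => by rw [hf]; rfl⟩

instance (F G : M.D .nat → M.D .nat) [Rep F] [Rep G] : Dec fun x => F x < G x :=
  inferInstanceAs (Dec fun x => F x + 1 ≤ G x)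

instance (F G : M.D .nat → M.D .nat) [Rep F] [Rep G] : Dec fun x => F x = G x := by
  obtain ⟨f, hf⟩ := (inferInstance : Dec fun x => F x ≤ G x ∧ G x ≤ F x)
  refine ⟨f, fun x => (hf x).trans ⟨fun h => le_antisymm' h.1 h.2, fun h => ?_⟩⟩
  rw [h]
  exact ⟨sub_self' _, sub_self' _⟩

instance (x : M.D .nat) : Dec (LE.le x) := inferInstanceAs (Dec fun y => x ≤ id y)

instance (x : M.D .nat) : Dec (LT.lt x) := inferInstanceAs (Dec fun y => x < id y)

instance (x : M.D .nat) : Dec (Eq x) := inferInstanceAs (Dec fun y => x = id y)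

/-- Induction in a model, for predicates given by the zeros of a represented function. -/
theorem induct {P : M.D .nat → Prop} (hP : Dec P) (h0 : P 0)
    (hs : ∀ x, P x → P (x + 1)) (x : M.D .nat) : P x := by
  obtain ⟨f, hf⟩ := hP
  -- The scheme is used for the single equation `f x = 0`; the parameter `f` then ranges over all
  -- represented functions.
  have := M.holds (Γ := [.one]) (A := _) ?_ (.ax (.ind (v1 ⬝ v0 ≐ .zero) trivial))
    (Env.cons f (Env.nil _))
  · refine (hf x).mp (this ⟨(hf 0).mpr h0, fun y hy => ?_⟩ x)
    have := (hf (y + 1)).mpr (hs y ((hf y).mp hy))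
    rw [← succ_eq] at this
    exact this
  · simp [Fm.Neg, Fm.inst, Fm.subst]

/-! ### The ordered monoid of numbers of a model -/

theorem zero_add' (x : M.D .nat) : 0 + x = x := by
  induction x using induct with
  | hP => infer_instance
  | h0 => exact add_zero' 0
  | hs x ih => rw [add_add_one, ih]

theorem add_one_add (x y : M.D .nat) : x + 1 + y = x + y + 1 := by
  induction y using induct with
  | hP => infer_instance
  | h0 => rw [add_zero', add_zero']
  | hs y ih => rw [add_add_one, ih, add_add_one]

instance : AddCommMonoid (M.D .nat) where
  add_assoc x y z := by
    induction z using induct with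
    | hP => infer_instance
    | h0 => rw [add_zero', add_zero']
    | hs z ih => rw [add_add_one, add_add_one, add_add_one, ih]
  zero_add := zero_add'
  add_zero := add_zero'
  add_comm x y := by
    induction y using induct with
    | hP => infer_instance
    | h0 => rw [add_zero', zero_add']
    | hs y ih => rw [add_add_one, add_one_add, ih]
  nsmul := nsmulRec

/-- Reduces the laws of the order to addition. Statements proved by induction keep the form with
`≤`, for which there is a `Dec` instance. -/
theorem le_iff_exists_add' {x y : M.D .nat} : x ≤ y ↔ ∃ z, x + z = y := by
  refine ⟨fun h => ⟨_, add_sub_of_le' h⟩, ?_⟩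
  rintro ⟨z, rfl⟩
  induction z using induct with
  | hP => infer_instance
  | h0 => rw [add_zero']; exact sub_self' x
  | hs z ih =>
    rw [le_def, add_add_one, sub_add_one, (le_def _ _).mp ih, pred_zero]

theorem add_right_cancel' {x y z : M.D .nat} (h : x + z = y + z) : x = y := by
  revert h
  induction z using induct with
  | hP => infer_instance
  | h0 => intro h; rwa [add_zero', add_zero'] at h
  | hs z ih =>
    intro h
    rw [add_add_one, add_add_one] at h
    exact ih (add_one_inj h)

theorem le_total' (x y : M.D .nat) : x ≤ y ∨ y ≤ x := by
  induction y using induct with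
  | hP => infer_instance
  | h0 => exact .inr (le_iff_exists_add'.mpr ⟨x, zero_add' x⟩)
  | hs y ih =>
    rw [le_iff_exists_add', le_iff_exists_add'] at ih
    rw [le_iff_exists_add', le_iff_exists_add']
    rcases ih with ⟨z, rfl⟩ | ⟨z, rfl⟩
    · exact .inl ⟨z + 1, add_add_one _ _⟩
    · rcases eq_zero_or_eq_add_one z with rfl | ⟨w, rfl⟩
      · exact .inl ⟨1, by rw [add_zero']⟩
      · exact .inr ⟨w, by rw [add_one_add, add_add_one]⟩

noncomputable instance : LinearOrder (M.D .nat) where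
  le_refl := sub_self'
  le_trans x y z := by
    rw [le_iff_exists_add', le_iff_exists_add', le_iff_exists_add']
    rintro ⟨u, rfl⟩ ⟨v, rfl⟩
    exact ⟨u + v, (add_assoc _ _ _).symm⟩
  lt_iff_le_not_ge x y := by
    rw [lt_def, le_iff_exists_add', le_iff_exists_add', le_iff_exists_add']
    constructor
    · rintro ⟨u, rfl⟩
      refine ⟨⟨1 + u, (add_assoc _ _ _).symm⟩, ?_⟩
      rintro ⟨v, h⟩
      have : x + (u + v + 1) = x + 0 := by
        rw [add_zero']
        refine Eq.trans ?_ h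
        abel
      rw [add_comm, add_comm x] at this
      exact add_one_ne_zero _ (add_right_cancel' this)
    · rintro ⟨⟨u, rfl⟩, h⟩
      rcases eq_zero_or_eq_add_one u with rfl | ⟨w, rfl⟩
      · exact (h ⟨0, by rw [add_zero', add_zero']⟩).elim
      · exact ⟨w, by rw [add_one_add, add_add_one]⟩
  le_antisymm _ _ := le_antisymm'
  le_total := le_total'
  toDecidableLE := Classical.decRel _

instance : IsOrderedCancelAddMonoid (M.D .nat) where
  add_le_add_left x y h z := by
    obtain ⟨u, rfl⟩ := le_iff_exists_add'.mp h
    exact le_iff_exists_add'.mpr ⟨u, by rw [add_right_comm]⟩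
  le_of_add_le_add_left x y z h := by
    obtain ⟨u, h⟩ := le_iff_exists_add'.mp h
    refine le_iff_exists_add'.mpr ⟨u, add_right_cancel' (z := x) ?_⟩
    rw [add_comm, ← add_assoc, h, add_comm]

instance : CanonicallyOrderedAdd (M.D .nat) where
  exists_add_of_le h := by
    obtain ⟨u, h⟩ := le_iff_exists_add'.mp h
    exact ⟨u, h.symm⟩
  le_add_self x y := le_iff_exists_add'.mpr ⟨y, add_comm _ _⟩
  le_self_add x y := le_iff_exists_add'.mpr ⟨y, rfl⟩

theorem add_one_le_iff {x y : M.D .nat} : x + 1 ≤ y ↔ x < y := Iff.rfl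

theorem lt_add_one_iff {x y : M.D .nat} : x < y + 1 ↔ x ≤ y := by
  rw [lt_def, add_le_add_iff_right]

/-- From here on the general lemmas on truncated subtraction in ordered monoids apply to the numbers
of a model. -/
instance : OrderedSub (M.D .nat) where
  tsub_le_iff_right x y z := by
    rcases le_total x y with h | h
    · rw [(le_def _ _).mp h]
      exact ⟨fun _ => h.trans le_add_self, fun _ => zero_le⟩
    · conv_rhs => rw [← add_sub_of_le' h, add_comm, add_le_add_iff_right]

end Model

/-! ### Terms for the reduction of `LPO` -/

/-- `R`-definition by cases: `z` if `x = 0`, and `y` otherwise. -/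
def condT {Γ : Ctx} (x y z : Tm Γ .nat) : Tm Γ .nat := .R ⬝ x ⬝ z ⬝ (.K _ .nat ⬝ (.K _ .nat ⬝ y))

/-- The function defined by primitive recursion from `y` and `z`. In `z`, variable `0` is the
argument and variable `1` the value of the function at it. -/
def precT {Γ : Ctx} (y : Tm Γ .nat) (z : Tm (.nat :: .nat :: Γ) .nat) : Tm Γ .one :=
  .lam (.R ⬝ v0 ⬝ y.wk ⬝ z.lam.lam.wk)

/-- Bounded sums: `bsumT p n = p 0 + … + p (n - 1)`. -/
def bsumT : Tm [] (.one ⇒ .nat ⇒ .nat) := .lam (precT .zero (addT ⬝ v1 ⬝ (v2 ⬝ v0)))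

/-- The graph assigned to `p` in the reduction of `LPO`: for `a < b`, the pair `(a, b)` is an edge
when `p` has a zero below `b`. -/
def graphT : Tm [] (.one ⇒ .one) :=
  .lam (.lam (bsumT.closed ⬝
    .lam (condT (v2 ⬝ v0) .zero (subT ⬝ num 1 ⬝ (subT ⬝ (triT ⬝ (.succ ⬝ v0)) ⬝ v1))) ⬝
    (.succ ⬝ v0)))

namespace Model

variable {M : Model}

/-! ### Primitive recursive functions in a model -/

theorem app_R_add_one (x y : M.D .nat) (z : M.D (.nat ⇒ .nat ⇒ .nat)) :
    M.app (M.app (M.app M.R (x + 1)) y) z = M.app (M.app z (M.app (M.app (M.app M.R x) y) z)) x := by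
  rw [← succ_eq, app_R_succ]

theorem eval_condT {Γ : Ctx} (e : Env M.toInterp Γ) (x y z : Tm Γ .nat) :
    (condT x y z).eval e = cond (x.eval e) (y.eval e) (z.eval e) := rfl

theorem eval_num_one {Γ : Ctx} (e : Env M.toInterp Γ) : (num 1 : Tm Γ .nat).eval e = 1 := rfl

theorem zero_lt_one' : (0 : M.D .nat) < 1 := by
  rw [lt_def, zero_add]

theorem eval_precT {Γ : Ctx} (y : Tm Γ .nat) (z : Tm (.nat :: .nat :: Γ) .nat)
    (e : Env M.toInterp Γ) (n : M.D .nat) : M.app ((precT y z).eval e) n =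
      M.app (M.app (M.app M.R n) (y.eval e)) (z.lam.lam.eval e) := by
  rw [precT, eval_lam, Tm.eval, Tm.eval, Tm.eval_wk, Tm.eval_wk]
  rfl

theorem eval_precT_zero {Γ : Ctx} (y : Tm Γ .nat) (z : Tm (.nat :: .nat :: Γ) .nat)
    (e : Env M.toInterp Γ) : M.app ((precT y z).eval e) 0 = y.eval e := by
  rw [eval_precT]
  exact app_R_zero _ _ _

theorem eval_precT_add_one {Γ : Ctx} (y : Tm Γ .nat) (z : Tm (.nat :: .nat :: Γ) .nat)
    (e : Env M.toInterp Γ) (n : M.D .nat) : M.app ((precT y z).eval e) (n + 1) =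
      z.eval (Env.cons n (Env.cons (M.app ((precT y z).eval e) n) e)) := by
  rw [eval_precT, app_R_add_one, eval_lam, eval_lam, ← eval_precT]

theorem eval_app {Γ : Ctx} {ρ τ : Ty} (f : Tm Γ (ρ ⇒ τ)) (a : Tm Γ ρ) (e : Env M.toInterp Γ) :
    (f ⬝ a).eval e = M.app (f.eval e) (a.eval e) := rfl

/-- Bounded sums in a model. -/
abbrev bsum (p : M.D .one) (n : M.D .nat) : M.D .nat :=
  M.app (M.app (bsumT.eval (Env.nil _)) p) n

theorem bsum_zero (p : M.D .one) : bsum p 0 = 0 := by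
  rw [bsum, bsumT, eval_lam, eval_precT_zero, eval_zero]

theorem bsum_add_one (p : M.D .one) (n : M.D .nat) : bsum p (n + 1) = bsum p n + M.app p n := by
  rw [bsum, bsum, bsumT, eval_lam, eval_precT_add_one, eval_addT]
  rfl

/-- Bounded sums replace bounded quantifiers, which the quantifier-free language lacks. -/
theorem bsum_eq_zero_iff {p : M.D .one} {n : M.D .nat} :
    bsum p n = 0 ↔ ∀ i < n, M.app p i = 0 := by
  constructor
  · intro h i hi
    -- The index `i` stays fixed, so that the predicate of `j` is free of quantifiers.
    have key (j : M.D .nat) : i < j → bsum p j = 0 → M.app p i = 0 := by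
      induction j using induct with
      | hP => infer_instance
      | h0 => exact fun h => (not_lt_zero h).elim
      | hs j ih =>
        intro hij h
        rw [bsum_add_one, add_eq_zero] at h
        rcases (lt_add_one_iff.mp hij).eq_or_lt with rfl | hij
        · exact h.2
        · exact ih hij h.1
    exact key n hi h
  · intro h
    have key (j : M.D .nat) : j ≤ n → bsum p j = 0 := by
      induction j using induct with
      | hP => infer_instance
      | h0 => exact fun _ => bsum_zero p
      | hs j ih =>
        intro hj
        rw [bsum_add_one, ih ((le_of_lt (add_one_le_iff.mp hj))), h j hj, add_zero]
    exact key n le_rfl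

/-- Triangular numbers in a model. -/
abbrev tri (x : M.D .nat) : M.D .nat := M.app (triT.eval (Env.nil _)) x

theorem eval_triT {Γ : Ctx} (e : Env M.toInterp Γ) (t : Tm Γ .nat) :
    (triT ⬝ t).eval e = tri (t.eval e) := by
  have : (triT : Tm Γ _).eval e = triT.eval (Env.nil _) := by
    simp only [triT, addT, Tm.lam, Tm.eval]
  simp only [Tm.eval, this]

theorem tri_add_one (x : M.D .nat) : tri (x + 1) = tri x + x := by
  simp only [tri, triT, eval_lam]
  refine (app_R_add_one _ _ _).trans ?_
  rw [eval_lam, eval_lam, eval_addT]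
  rfl

theorem tri_mono {x y : M.D .nat} (h : x ≤ y) : tri x ≤ tri y := by
  obtain ⟨z, rfl⟩ := exists_add_of_le h
  induction z using induct with
  | hP => infer_instance
  | h0 => rw [add_zero]
  | hs z ih =>
    rw [← add_assoc, tri_add_one]
    exact (ih le_self_add).trans le_self_add

/-- The code of a pair of vertices in a model. -/
abbrev pairCode (a b : M.D .nat) : M.D .nat := tri b + a

theorem eval_codeT {Γ : Ctx} (e : Env M.toInterp Γ) (s t : Tm Γ .nat) :
    (codeT ⬝ s ⬝ t).eval e = pairCode (s.eval e) (t.eval e) := by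
  change M.app (M.app (codeT.eval e) _) _ = _
  rw [codeT, eval_lam, eval_lam, eval_addT, eval_triT]
  rfl

/-- For `a < b` the code of `(a, b)` lies in the interval from `tri b` to `tri (b + 1)`, the right
end excluded. Comparing with triangular numbers thus reads off `i < b` without decoding the pair. -/
theorem tri_add_one_le_pairCode {a b i : M.D .nat} (hab : a < b) :
    tri (i + 1) ≤ pairCode a b ↔ i < b := by
  constructor
  · intro h
    by_contra hb
    have h' : tri (b + 1) ≤ tri (i + 1) := tri_mono (by simpa using hb)
    rw [tri_add_one b] at h'
    exact absurd (h'.trans h) (by simpa using hab)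
  · intro h
    exact (tri_mono h).trans le_self_add

theorem sub_eq_zero_iff {x y : M.D .nat} : x - y = 0 ↔ x ≤ y := Iff.rfl

/-- The graph assigned to `p`, in a model. -/
abbrev graph (p : M.D .one) : M.D .one := M.app (graphT.eval (Env.nil _)) p

theorem one_sub_ne_zero_iff {x : M.D .nat} : 1 - x ≠ 0 ↔ x = 0 := by
  rw [Ne, sub_eq_zero_iff, not_le]
  have := lt_add_one_iff (x := x) (y := 0)
  rw [zero_add] at this
  rw [this, nonpos_iff_eq_zero]

theorem graph_ne_zero_iff {p : M.D .one} {x : M.D .nat} :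
    M.app (graph p) x ≠ 0 ↔ ∃ i ≤ x, M.app p i = 0 ∧ tri (i + 1) ≤ x := by
  rw [graph, graphT, eval_lam, eval_lam, eval_app, eval_app, Tm.eval_closed, eval_succ]
  change bsum _ _ ≠ 0 ↔ _
  rw [Ne, bsum_eq_zero_iff]
  push Not
  refine exists_congr fun i => ?_
  rw [eval_lam, eval_condT]
  change i < x + 1 ∧ _ ↔ _
  rw [lt_add_one_iff]
  refine and_congr_right fun _ => ?_
  by_cases hp : M.app p i = 0
  · have : (v2 ⬝ v0 : Tm [.nat, .nat, .one] .nat).eval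
      (Env.cons i (Env.cons x (Env.cons p (Env.nil M.toInterp)))) = 0 := hp
    rw [this, cond_zero, eval_subT, eval_subT, eval_triT, eval_succ]
    exact one_sub_ne_zero_iff.trans (by simp only [hp, true_and]; rfl)
  · have : (v2 ⬝ v0 : Tm [.nat, .nat, .one] .nat).eval
      (Env.cons i (Env.cons x (Env.cons p (Env.nil M.toInterp)))) ≠ 0 := hp
    rw [cond_of_ne this]
    simp [hp, eval_zero]

theorem graph_pairCode {p : M.D .one} {a b : M.D .nat} (hab : a < b) :
    M.app (graph p) (pairCode a b) ≠ 0 ↔ ∃ i < b, M.app p i = 0 := by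
  rw [graph_ne_zero_iff]
  constructor
  · rintro ⟨i, -, hp, hi⟩
    exact ⟨i, (tri_add_one_le_pairCode hab).mp hi, hp⟩
  · rintro ⟨i, hi, hp⟩
    have h := (tri_add_one_le_pairCode hab).mpr hi
    refine ⟨i, le_trans ?_ h, hp, h⟩
    rw [tri_add_one]
    exact le_add_self

/-! ### Colorings in a model -/

/-- `f` is a `k`-coloring of the subgraph on `0, …, m` of the graph coded by `G`. -/
def IsColoring (k : M.D .nat) (G : M.D .one) (m : M.D .nat) (f : M.D .one) : Prop :=
  (∀ a ≤ m, M.app f a < k) ∧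
    ∀ a b, a < b → b ≤ m → M.app G (pairCode a b) ≠ 0 → M.app f a ≠ M.app f b

/-- `c` is the characteristic function of colorability. -/
structure Decides (c : M.D .col) : Prop where
  eq_one : ∀ {k G m f}, IsColoring k G m f → M.app (M.app (M.app c k) G) m = 1
  eq_zero : ∀ {k G m}, (∀ f, ¬ IsColoring k G m f) → M.app (M.app (M.app c k) G) m = 0

theorem one_ne_zero' : (1 : M.D .nat) ≠ 0 := zero_lt_one'.ne'

theorem Decides.eq_zero_or_eq_one {c : M.D .col} (hc : Decides c) (k : M.D .nat) (G : M.D .one)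
    (m : M.D .nat) :
    M.app (M.app (M.app c k) G) m = 0 ∨ M.app (M.app (M.app c k) G) m = 1 := by
  by_cases h : ∃ f, IsColoring k G m f
  · obtain ⟨f, hf⟩ := h
    exact .inr (hc.eq_one hf)
  · exact .inl (hc.eq_zero fun f hf => h ⟨f, hf⟩)

/-- The pigeonhole principle: the complete graph on `k + 1` vertices has no `k`-coloring. -/
theorem Decides.complete_eq_zero {c : M.D .col} (hc : Decides c) (k : M.D .nat) :
    M.app (M.app (M.app c k) (M.app (M.K _ .nat) 1)) k = 0 := by
  -- The claim is an equation between values of `c`, hence a predicate admitted for induction,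
  -- although uncolorability quantifies over all `f`.
  induction k using induct with
  | hP => infer_instance
  | h0 => exact hc.eq_zero fun f hf => not_lt_zero (hf.1 0 le_rfl)
  | hs k ih =>
    refine hc.eq_zero fun f hf => ?_
    have inj {a b} (hab : a < b) (hb : b ≤ k + 1) : M.app f a ≠ M.app f b :=
      hf.2 a b hab hb (by rw [app_K]; exact one_ne_zero')
    -- Vertices colored `k` receive the color of the last vertex `k + 1`. The sum of the two
    -- truncated differences vanishes exactly when `f a = k`, and `cond` returns its last argument
    -- at `0`.
    obtain ⟨g, hg⟩ := (inferInstance : Rep fun a =>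
      cond ((M.app f a - k) + (k - M.app f a)) (M.app f a) (M.app f (k + 1)))
    have hg1 {a} (h : M.app f a = k) : M.app g a = M.app f (k + 1) := by
      rw [hg, h, tsub_self, add_zero, cond_zero]
    have hg2 {a} (h : M.app f a ≠ k) : M.app g a = M.app f a := by
      rw [hg, cond_of_ne]
      intro h'
      rw [add_eq_zero] at h'
      exact h (le_antisymm h'.1 h'.2)
    have lt_k {a} (ha : a ≤ k + 1) (h : M.app f a ≠ k) : M.app f a < k :=
      (lt_add_one_iff.mp (hf.1 a ha)).lt_of_ne h
    have hle {a} (ha : a ≤ k) : a < k + 1 := lt_add_one_iff.mpr ha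
    -- The new function `g` colors the complete graph on `0, …, k` with `k` colors, contrary to the
    -- induction hypothesis.
    refine one_ne_zero' ((hc.eq_one (f := g) ⟨fun a ha => ?_, fun a b hab hb _ => ?_⟩).symm.trans ih)
    · by_cases h : M.app f a = k
      · rw [hg1 h]
        -- If `f a = k`, the last vertex has another color, which is therefore below `k`.
        exact lt_k le_rfl fun h' => inj (hle ha) le_rfl (h.trans h'.symm)
      · rw [hg2 h]
        exact lt_k (hle ha).le h
    · have ha : a ≤ k := hab.le.trans hb
      by_cases h : M.app f a = k <;> by_cases h' : M.app f b = k
      · exact (inj hab (hle hb).le (h.trans h'.symm)).elim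
      · rw [hg1 h, hg2 h']
        exact (inj (hle hb) le_rfl).symm
      · rw [hg2 h, hg1 h']
        exact inj (hle ha) le_rfl
      · rw [hg2 h, hg2 h']
        exact inj hab (hle hb).le

/-- The vertices `i, …, i + k` form a clique, so a coloring shifted by `i` would color the complete
graph on `k + 1` vertices. -/
theorem Decides.graph_eq_zero {c : M.D .col} (hc : Decides c) {k m i : M.D .nat} {p : M.D .one}
    (hp : M.app p i = 0) (hi : i + k ≤ m) : M.app (M.app (M.app c k) (graph p)) m = 0 := by
  refine hc.eq_zero fun f hf => ?_
  obtain ⟨g, hg⟩ := (inferInstance : Rep fun a => M.app f (i + a))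
  have hm {a} (ha : a ≤ k) : i + a ≤ m := (add_le_add_right ha i).trans hi
  refine one_ne_zero' ((hc.eq_one (f := g) ⟨fun a ha => ?_, fun a b hab hb _ => ?_⟩).symm.trans
    (hc.complete_eq_zero k))
  · rw [hg]
    exact hf.1 _ (hm ha)
  · rw [hg, hg]
    have hab' : i + a < i + b := add_lt_add_right hab i
    exact hf.2 _ _ hab' (hm hb) ((graph_pairCode hab').mpr ⟨i, le_self_add.trans_lt hab', hp⟩)

theorem Decides.graph_eq_one {c : M.D .col} (hc : Decides c) {k m : M.D .nat} {p : M.D .one}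
    (hk : 1 ≤ k) (hp : ∀ i, i + k ≤ m → M.app p i ≠ 0) :
    M.app (M.app (M.app c k) (graph p)) m = 1 := by
  -- Put `d = m + 1 - k`. Vertices up to `d` are colored `0` and the later ones increasingly, with
  -- values below `k`. An edge into `b` comes from a zero `i < b`; the hypothesis gives `m < i + k`,
  -- so `d ≤ i < b` and the color of `b` exceeds that of `a`.
  obtain ⟨g, hg⟩ := (inferInstance : Rep fun a => a - (m + 1 - k))
  refine hc.eq_one (f := g) ⟨fun a ha => ?_, fun a b hab hb he => ?_⟩
  · rw [hg]
    have hd : m + 1 ≤ m + 1 - k + k := le_tsub_add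
    rcases le_total a (m + 1 - k) with h | h
    · rw [tsub_eq_zero_of_le h]
      exact zero_lt_one'.trans_le hk
    · rw [tsub_lt_iff_left h]
      exact (lt_add_one_iff.mpr ha).trans_le hd
  · rw [hg, hg]
    obtain ⟨i, hi, h0⟩ := (graph_pairCode hab).mp he
    have hmk : m < i + k := by
      by_contra h
      exact hp i (not_lt.mp h) h0
    have hd : m + 1 - k < b := (tsub_le_iff_right.mpr hmk).trans_lt hi
    rcases le_total a (m + 1 - k) with h | h
    · rw [tsub_eq_zero_of_le h]
      exact (tsub_pos_of_lt hd).ne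
    · exact ((tsub_lt_tsub_iff_right h).mpr hab).ne

/-! ### The reductions in a model -/

/-- `n` is a solution of `LPO` for `p`. -/
def SolLPO (p : M.D .one) (n : M.D .nat) : Prop :=
  (n = 0 → ∀ i, 0 < M.app p i) ∧
    (0 < n → M.app p (pred n) = 0 ∧ ∀ t, t < pred n → 0 < M.app p t)

/-- `n` is a solution of `LGk` for `G`. -/
def SolLG (c : M.D .col) (k : M.D .nat) (G : M.D .one) (n : M.D .nat) : Prop :=
  (n = 0 → ∀ m, M.app (M.app (M.app c k) G) m = 1) ∧
    (0 < n → M.app (M.app (M.app c k) G) n = 0 ∧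
      ∀ t, t < n → M.app (M.app (M.app c k) G) t = 1)

/-- As `c` takes only the values `0` and `1`, its first zero is the first uncolorable part; `LPO`
reports that position plus one. -/
theorem Decides.solLG_of_solLPO {c : M.D .col} (hc : Decides c) {k : M.D .nat} (hk : 1 ≤ k)
    {G : M.D .one} {n : M.D .nat} (h : SolLPO (M.app (M.app c k) G) n) : SolLG c k G (pred n) := by
  have one_of_pos {m} (hm : 0 < M.app (M.app (M.app c k) G) m) :
      M.app (M.app (M.app c k) G) m = 1 :=
    (hc.eq_zero_or_eq_one k G m).resolve_left hm.ne'
  have at_zero : M.app (M.app (M.app c k) G) 0 = 1 := by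
    refine hc.eq_one (f := M.app (M.K _ .nat) 0) ⟨fun a _ => ?_, fun a b hab hb => ?_⟩
    · rw [app_K]
      exact zero_lt_one'.trans_le hk
    · exact (not_lt_zero (hab.trans_le hb)).elim
  rcases eq_zero_or_eq_add_one n with rfl | ⟨n, rfl⟩
  · rw [pred_zero]
    exact ⟨fun _ m => one_of_pos (h.1 rfl m), fun h => (lt_irrefl _ h).elim⟩
  · have h2 := h.2 (pos_iff_ne_zero.mpr (add_one_ne_zero n))
    rw [pred_add_one] at h2 ⊢
    refine ⟨?_, fun _ => ⟨h2.1, fun t ht => one_of_pos (h2.2 t ht)⟩⟩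
    -- A first zero at position `0` would collide with the answer "always colorable"; it is excluded
    -- by the colorability of a single vertex.
    rintro rfl
    exact (one_ne_zero' (at_zero.symm.trans h2.1)).elim

theorem Decides.solLPO_of_solLG {c : M.D .col} (hc : Decides c) {k : M.D .nat} (hk : 1 ≤ k)
    {p : M.D .one} {n : M.D .nat} (h : SolLG c k (graph p) n) :
    SolLPO p (cond n (n + 1 - k) 0) := by
  by_cases hn : n = 0
  · rw [hn, cond_zero]
    refine ⟨fun _ i => pos_iff_ne_zero.mpr fun hp => ?_, fun h => (lt_irrefl _ h).elim⟩
    exact one_ne_zero' ((h.1 hn (i + k)).symm.trans (hc.graph_eq_zero hp le_rfl))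
  · obtain ⟨h0, h1⟩ := h.2 (pos_iff_ne_zero.mpr hn)
    obtain ⟨i, hi, hp⟩ : ∃ i, i + k ≤ n ∧ M.app p i = 0 := by
      by_contra hcon
      push Not at hcon
      exact one_ne_zero' ((hc.graph_eq_one hk hcon).symm.trans h0)
    have no_lt {t} (ht : t + k < n) : 0 < M.app p t := pos_iff_ne_zero.mpr fun hp =>
      one_ne_zero' ((h1 _ ht).symm.trans (hc.graph_eq_zero hp le_rfl))
    -- A zero at `i` already makes the part with `m = i + k` uncolorable, so minimality of `n`
    -- excludes `i + k < n`.
    obtain rfl : n = i + k := by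
      by_contra hne
      exact (no_lt (lt_of_le_of_ne hi (Ne.symm hne))).ne' hp
    have hs : i + k + 1 - k = i + 1 := by
      rw [add_right_comm, add_tsub_cancel_right]
    rw [cond_of_ne hn, hs]
    refine ⟨fun h => (add_one_ne_zero _ h).elim, fun _ => ?_⟩
    rw [pred_add_one]
    exact ⟨hp, fun t ht => no_lt (add_lt_add_left ht k)⟩

end Model

/-! ### Formulas about colorings, evaluated in models -/

/-- The matrix of `colorable`: variable `0` is a `k`-coloring of the subgraph on `0, …, m`. -/
def coloringFm {Γ : Ctx} (k : Tm Γ .nat) (e : Tm Γ .one) (m : Tm Γ .nat) : Fm (.one :: Γ) :=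
  .all .nat (le v0 m.wk.wk ⟶' lt (v1 ⬝ v0) k.wk.wk) ⋏
    .all .nat (.all .nat (lt v1 v0 ⟶' le v0 m.wk.wk.wk ⟶' edge e.wk.wk.wk v1 v0 ⟶'
      .neg (v2 ⬝ v1 ≐ v2 ⬝ v0)))

theorem colorable_eq {Γ : Ctx} (k : Tm Γ .nat) (e : Tm Γ .one) (m : Tm Γ .nat) :
    colorable k e m = .ex .one (coloringFm k e m) := rfl

theorem coloringFm_neg {Γ : Ctx} (k : Tm Γ .nat) (e : Tm Γ .one) (m : Tm Γ .nat) :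
    (coloringFm k e m).Neg := by
  simp [coloringFm, Fm.Neg, le, lt, edge, Fm.neg]

section Eval

variable {M : Model} {Γ : Ctx}

open Model

theorem eval_coloringFm (k : Tm Γ .nat) (G : Tm Γ .one) (m : Tm Γ .nat) (f : M.D .one)
    (e : Env M.toInterp Γ) :
    (coloringFm k G m).eval (Env.cons f e) ↔ IsColoring (k.eval e) (G.eval e) (m.eval e) f := by
  simp only [coloringFm, Fm.eval, eval_le, eval_lt, Tm.eval_wk, edge, Fm.neg]
  refine and_congr (forall_congr' fun a => Iff.rfl) (forall_congr' fun a => forall_congr' fun b => ?_)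
  refine imp_congr_right fun _ => imp_congr_right fun _ => imp_congr_left ?_
  refine not_congr ?_
  have : (G.wk.wk.wk ⬝ (codeT ⬝ v1 ⬝ v0)).eval (Env.cons b (Env.cons a (Env.cons f e))) =
      M.app (G.eval e) (pairCode a b) := by
    rw [Tm.eval, eval_codeT, Tm.eval_wk, Tm.eval_wk, Tm.eval_wk]
    rfl
  rw [this]
  rfl

theorem eval_solLPO (p : M.D .one) (n : M.D .nat) (e : Env M.toInterp Γ) :
    (LPO Γ).sol.eval (Env.cons n (Env.cons p e)) ↔ SolLPO p n := by
  simp only [LPO, Fm.eval, eval_lt]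
  refine and_congr Iff.rfl (imp_congr_right fun _ => and_congr ?_ (forall_congr' fun t => ?_))
  · change M.app p ((predT ⬝ v0).eval _) = 0 ↔ _
    rw [eval_predT]
    rfl
  · rw [eval_predT]
    rfl

theorem eval_solLG (c : Tm [] .col) (k : Tm Γ .nat) (G : M.D .one) (n : M.D .nat)
    (e : Env M.toInterp Γ) :
    (LG c k).sol.eval (Env.cons n (Env.cons G e)) ↔
      SolLG (c.eval (Env.nil _)) (k.eval e) G n := by
  simp only [LG, Fm.eval, eval_lt, Tm.eval, Tm.eval_wk, Tm.eval_closed]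
  rfl

end Eval

/-! ### The hypothesis on `c` in negative form -/

/-- With `Prf.neg_of_dichotomy`, this removes `∨` and `∃` from the hypothesis on `c`; the resulting
sentences are negative and so hold in every model. -/
theorem Prf.imp_of_dichotomy {Γ : Ctx} {H : List (Fm Γ)} {σ : Ty} {B : Fm (σ :: Γ)} {P Q : Fm Γ}
    (h : Prf H (.ex σ B ⋏ P ⋎ (Fm.ex σ B).neg ⋏ Q)) : Prf H (.all σ (B ⟶' P.wk)) := by
  refine .allI (.impI (.orE h.wk.weaken (.andE₂ .head) (.botE ?_)))
  refine .impE (.andE₁ .head) (.exI (.var .z) ?_)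
  rw [Fm.lift_shift_inst_var]
  exact Prf.head.weaken

theorem Prf.neg_of_dichotomy {Γ : Ctx} {H : List (Fm Γ)} {σ : Ty} {B : Fm (σ :: Γ)} {P Q : Fm Γ}
    (h : Prf H (.ex σ B ⋏ P ⋎ (Fm.ex σ B).neg ⋏ Q)) : Prf H (.all σ B.neg ⟶' Q) := by
  refine .impI (.orE h.weaken (.botE (.exE (.andE₁ .head) ?_)) (.andE₂ .head))
  refine Prf.impE ?_ .head
  have := Prf.ofAll (H := (.ex σ B ⋏ P) :: .all σ B.neg :: H) (A := B.neg) Prf.head.weaken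
  exact this.weaken

/-- If `f` is a coloring then `c` has the value `1`. -/
def colorableSentence (c : Tm [] .col) : Fm [] :=
  .all .nat (.all .one (.all .nat (.all .one
    (coloringFm v2 v1 v0 ⟶' (c.closed ⬝ v2 ⬝ v1 ⬝ v0 ≐ num 1).wk))))

/-- If there is no coloring then `c` has the value `0`. -/
def uncolorableSentence (c : Tm [] .col) : Fm [] :=
  .all .nat (.all .one (.all .nat
    (.all .one (coloringFm v2 v1 v0).neg ⟶' c.closed ⬝ v2 ⬝ v1 ⬝ v0 ≐ .zero)))

theorem provable_colorableSentence {c : Tm [] .col} (h : Provable (decidesColorable c)) :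
    Provable (colorableSentence c) :=
  .allI (.allI (.allI (Prf.ofAll (Prf.ofAll (Prf.ofAll h))).imp_of_dichotomy))

theorem provable_uncolorableSentence {c : Tm [] .col} (h : Provable (decidesColorable c)) :
    Provable (uncolorableSentence c) :=
  .allI (.allI (.allI (Prf.ofAll (Prf.ofAll (Prf.ofAll h))).neg_of_dichotomy))

open Model in
theorem decides_of_eval {M : Model} {c : Tm [] .col}
    (h1 : (colorableSentence c).eval (Env.nil M.toInterp))
    (h0 : (uncolorableSentence c).eval (Env.nil M.toInterp)) :
    Decides (M := M) (c.eval (Env.nil _)) := by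
  simp only [colorableSentence, uncolorableSentence, Fm.eval, eval_coloringFm, Fm.eval_wk,
    Fm.neg, Tm.eval, Tm.eval_closed] at h1 h0
  exact ⟨fun {k G m f} h => h1 k G m f h, fun {k G m} h => h0 k G m h⟩

/-- Completeness relative to a term that provably decides colorability. -/
theorem complete_of_decides {c : Tm [] .col} (hc : Provable (decidesColorable c)) {Γ : Ctx}
    {H : List (Fm Γ)} {A : Fm Γ} (hA : A.Neg)
    (h : ∀ (M : Model) (e : Env M.toInterp Γ), Model.Decides (M := M) (c.eval (Env.nil _)) →
      (∀ B ∈ H, B.Neg → B.eval e) → A.eval e) : Prf H A := by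
  have n1 : (colorableSentence c).Neg :=
    ⟨coloringFm_neg _ _ _, trivial⟩
  have n0 : (uncolorableSentence c).Neg :=
    ⟨⟨coloringFm_neg _ _ _, trivial⟩, trivial⟩
  refine Prf.cut (.of_sentence (provable_colorableSentence hc))
    (Prf.cut (.of_sentence (provable_uncolorableSentence hc)) (complete hA fun M e hH => ?_))
  refine h M e (decides_of_eval ?_ ?_) fun B hB =>
    hH B (List.mem_cons_of_mem _ (List.mem_cons_of_mem _ hB))
  · exact (Fm.eval_sentence _ _).mp (hH _ (by simp) (n1.subst _))
  · exact (Fm.eval_sentence _ _).mp (hH _ (by simp) (n0.subst _))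

/-! ### The reductions -/

/-- Negative problems: domain and solution are negative formulas. -/
structure Problem.IsNeg {Γ : Ctx} {ρ τ : Ty} (P : Problem Γ ρ τ) : Prop where
  dom : P.dom.Neg
  sol : P.sol.Neg

theorem LPO_isNeg (Γ : Ctx) : (LPO Γ).IsNeg := by
  constructor <;> simp [LPO, Fm.top, Fm.Neg, lt, le]

theorem LG_isNeg (c : Tm [] .col) {Γ : Ctx} (k : Tm Γ .nat) : (LG c k).IsNeg := by
  constructor <;> simp [LG, Fm.top, Fm.Neg, lt, le]

/-- A reduction between negative problems by given terms may be verified in models. -/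
theorem Prf.reduces_of {c : Tm [] .col} (hc : Provable (decidesColorable c)) {Γ : Ctx}
    {H : List (Fm Γ)} {ρ τ ρ' τ' : Ty} {Q : Problem Γ ρ' τ'} {P : Problem Γ ρ τ} (hQ : Q.IsNeg)
    (hP : P.IsNeg) (Φ : Tm Γ (ρ' ⇒ ρ)) (Ψ : Tm Γ (τ ⇒ τ'))
    (h : ∀ (M : Model) (e : Env M.toInterp Γ), Model.Decides (M := M) (c.eval (Env.nil _)) →
      (∀ B ∈ H, B.Neg → B.eval e) → ∀ (u : M.D ρ') (y : M.D τ), Q.dom.eval (Env.cons u e) →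
        P.dom.eval (Env.cons (M.app (Φ.eval e) u) e) ∧
          (P.sol.eval (Env.cons y (Env.cons (M.app (Φ.eval e) u) e)) →
            Q.sol.eval (Env.cons (M.app (Ψ.eval e) y) (Env.cons u e)))) :
    Prf H (Q.reduces P) := by
  refine .exI Φ (.exI Ψ (complete_of_decides hc ?_ fun M e hd hH => ?_))
  · refine Fm.Neg.subst (Fm.Neg.subst ?_ _) _
    exact ⟨hQ.dom.subst _, hP.dom.subst _, hP.sol.subst _, hQ.sol.subst _⟩
  · rw [Fm.eval_inst, Fm.eval_subst, Sub.eval_lift, Sub.eval_cons]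
    intro u y
    simp only [Fm.eval, Fm.eval_subst, Sub.eval_cons, Sub.eval_wk, Sub.eval_id]
    exact h M e hd hH u y

section Reductions

variable {c : Tm [] .col} {Γ : Ctx} {H : List (Fm Γ)} {k j : Tm Γ .nat}

open Model

/-- The map from solutions of `LGk` to solutions of `LPO`. -/
def backT (k : Tm Γ .nat) : Tm Γ (.nat ⇒ .nat) :=
  .lam (condT v0 (subT ⬝ (.succ ⬝ v0) ⬝ k.wk) .zero)

theorem eval_backT {M : Model} (k : Tm Γ .nat) (e : Env M.toInterp Γ) (n : M.D .nat) :
    M.app ((backT k).eval e) n = cond n (n + 1 - k.eval e) 0 := by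
  rw [backT, eval_lam, eval_condT, eval_subT, eval_succ, Tm.eval_wk]
  rfl

theorem eval_one_le {M : Model} {e : Env M.toInterp Γ} (hH : ∀ B ∈ H, B.Neg → B.eval e)
    (hk : le (num 1) k ∈ H) : 1 ≤ k.eval e :=
  (eval_le _ _ _).mp (hH _ hk trivial)

theorem LG_reduces_LPO (hc : Provable (decidesColorable c)) (hk : Prf H (le (num 1) k)) :
    Prf H ((LG c k).reduces (LPO Γ)) := by
  -- The bound `1 ≤ k` is made a hypothesis of the derivation, so that it is true in the models
  -- considered.
  refine hk.cut (.reduces_of hc (LG_isNeg c k) (LPO_isNeg Γ) (c.closed ⬝ k) predT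
    fun M e hd hH u y _ => ⟨id, ?_⟩)
  have hp : M.app (predT.eval e) y = pred y := eval_predT (Env.cons y e) v0
  rw [eval_solLPO, eval_solLG, Tm.eval, Tm.eval_closed, hp]
  exact hd.solLG_of_solLPO (eval_one_le hH List.mem_cons_self)

theorem LPO_reduces_LG (hc : Provable (decidesColorable c)) (hk : Prf H (le (num 1) k)) :
    Prf H ((LPO Γ).reduces (LG c k)) := by
  refine hk.cut (.reduces_of hc (LPO_isNeg Γ) (LG_isNeg c k) graphT.closed (backT k)
    fun M e hd hH u y _ => ⟨id, ?_⟩)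
  rw [eval_solLPO, eval_solLG, Tm.eval_closed, eval_backT]
  exact hd.solLPO_of_solLG (eval_one_le hH List.mem_cons_self)

/-- The functionals are the composites of the reductions `LGk` to `LPO` and `LPO` to `LGj`; no order
between `k` and `j` is needed. -/
theorem LG_reduces_LG (hc : Provable (decidesColorable c)) (hk : Prf H (le (num 1) k))
    (hj : Prf H (le (num 1) j)) : Prf H ((LG c k).reduces (LG c j)) := by
  refine hk.cut (hj.weaken.cut (.reduces_of hc (LG_isNeg c k) (LG_isNeg c j)
    (.lam (graphT.closed ⬝ (c.closed ⬝ k.wk ⬝ v0))) (.lam (predT ⬝ ((backT j).wk ⬝ v0)))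
    fun M e hd hH u y _ => ⟨id, ?_⟩))
  have hΦ : (graphT.closed ⬝ (c.closed ⬝ k.wk ⬝ v0)).eval (Env.cons u e) =
      graph (M.app (M.app (c.eval (Env.nil _)) (k.eval e)) u) := by
    simp only [Tm.eval, Tm.eval_closed, Tm.eval_wk]
    rfl
  have hΨ : (predT ⬝ ((backT j).wk ⬝ v0)).eval (Env.cons y e) =
      pred (cond y (y + 1 - j.eval e) 0) := by
    rw [eval_predT, ← eval_backT, Tm.eval, Tm.eval_wk]
    rfl
  rw [eval_solLG, eval_solLG, eval_lam, eval_lam, hΦ, hΨ]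
  intro h
  exact hd.solLG_of_solLPO (eval_one_le hH (by simp))
    (hd.solLPO_of_solLG (eval_one_le hH (by simp)) h)

theorem LPO_equiv_LG (hc : Provable (decidesColorable c)) (hk : Prf H (le (num 1) k)) :
    Prf H ((LPO Γ).equiv (LG c k)) :=
  .andI (LPO_reduces_LG hc hk) (LG_reduces_LPO hc hk)

theorem LG_equiv_LG (hc : Provable (decidesColorable c)) (hk : Prf H (le (num 1) k))
    (hj : Prf H (le (num 1) j)) : Prf H ((LG c k).equiv (LG c j)) :=
  .andI (LG_reduces_LG hc hk hj) (LG_reduces_LG hc hj hk)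

theorem provable_localColoringSentence (hc : Provable (decidesColorable c)) :
    Provable (localColoringSentence c) := by
  refine .allI (.allI (.impI (.impI ?_)))
  have hk : Prf [le v1 v0, le (num 1) v1] (le (num 1) (v1 : Tm [.nat, .nat] .nat)) :=
    Prf.head.weaken
  have hj : Prf [le v1 v0, le (num 1) v1] (le (num 1) (v0 : Tm [.nat, .nat] .nat)) := by
    refine complete trivial fun M e hH => (eval_le _ _ _).mpr ?_
    have h1 := (eval_le _ _ _).mp (hH (le (num 1) v1) (by simp) trivial)
    have h2 := (eval_le _ _ _).mp (hH (le v1 v0) (by simp) trivial)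
    exact h1.trans h2
  exact .andI (LPO_equiv_LG hc hk) (LG_equiv_LG hc hk hj)

theorem one_le_num_add_one (n : ℕ) : Prf H (le (num 1) (num (n + 1))) := by
  refine complete trivial fun M e _ => (eval_le _ _ _).mpr ?_
  rw [eval_num_one, num, eval_succ]
  exact le_add_self

end Reductions

/-! ### A term deciding colorability

A function on `0, …, m` with values below `k` is coded by the number with these digits in base
`k`, so that a coloring is found by a bounded search. -/

/-- The remainder of `s` modulo `k`. -/
def remT : Tm [] (.nat ⇒ .nat ⇒ .nat) :=
  .lam (precT .zero (condT (subT ⬝ v2 ⬝ (.succ ⬝ v1)) (.succ ⬝ v1) .zero))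

/-- The quotient of `s` by `k`. -/
def quoT : Tm [] (.nat ⇒ .nat ⇒ .nat) :=
  .lam (precT .zero
    (condT (subT ⬝ v2 ⬝ (.succ ⬝ (remT.closed ⬝ v2 ⬝ v0))) v1 (.succ ⬝ v1)))

/-- The product of `k` and `q`. -/
def mulT : Tm [] (.nat ⇒ .nat ⇒ .nat) := .lam (precT .zero (addT ⬝ v1 ⬝ v2))

/-- The power of `k` with exponent `n`. -/
def powT : Tm [] (.nat ⇒ .nat ⇒ .nat) := .lam (precT (num 1) (mulT.closed ⬝ v2 ⬝ v1))

/-- The number `s` without its last `j` digits in base `k`. -/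
def shiftT : Tm [] (.nat ⇒ .nat ⇒ .nat ⇒ .nat) :=
  .lam (.lam (precT v0 (quoT.closed ⬝ v3 ⬝ v1)))

/-- The number with the digits `f 0, …, f (n - 1)` in base `k`. -/
def encT : Tm [] (.nat ⇒ .one ⇒ .nat ⇒ .nat) :=
  .lam (.lam (precT .zero (addT ⬝ (mulT.closed ⬝ v3 ⬝ v1) ⬝ (v2 ⬝ v0))))

/-- The digit of `s` with index `a`, when `s` is written with `m + 1` digits in base `k`. -/
def digT : Tm [] (.nat ⇒ .nat ⇒ .nat ⇒ .nat ⇒ .nat) :=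
  .lam (.lam (.lam (.lam (remT.closed ⬝ v3 ⬝ (shiftT.closed ⬝ v3 ⬝ v2 ⬝ (subT ⬝ v1 ⬝ v0))))))

/-- `1` or `0` according to whether the arguments are equal. -/
def eqT {Γ : Ctx} (s t : Tm Γ .nat) : Tm Γ .nat :=
  subT ⬝ num 1 ⬝ (addT ⬝ (subT ⬝ s ⬝ t) ⬝ (subT ⬝ t ⬝ s))

/-- The number of edges `(a, b)` with `b ≤ m` whose ends have the same digit in `s`. -/
def badT : Tm [] (.nat ⇒ .one ⇒ .nat ⇒ .nat ⇒ .nat) :=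
  .lam (.lam (.lam (.lam (bsumT.closed ⬝
    .lam (bsumT.closed ⬝
      .lam (condT (.var (.s (.s (.s (.s .z)))) ⬝ (codeT ⬝ v0 ⬝ v1))
        (eqT (digT.closed ⬝ .var (.s (.s (.s (.s (.s .z))))) ⬝ v2 ⬝ v3 ⬝ v0)
          (digT.closed ⬝ .var (.s (.s (.s (.s (.s .z))))) ⬝ v2 ⬝ v3 ⬝ v1)) .zero) ⬝ v0) ⬝
    (.succ ⬝ v1)))))

/-- The last zero of `p` below `n`, if there is one. -/
def findT : Tm [] (.one ⇒ .nat ⇒ .nat) :=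
  .lam (precT .zero (condT (v2 ⬝ v0) v1 v0))

/-- The code of a coloring, if there is one. -/
def searchT : Tm [] .col :=
  .lam (.lam (.lam (findT.closed ⬝ (badT.closed ⬝ v2 ⬝ v1 ⬝ v0) ⬝
    (powT.closed ⬝ v2 ⬝ (.succ ⬝ v0)))))

/-- The characteristic function of colorability. -/
def colT : Tm [] .col :=
  .lam (.lam (.lam (condT v2
    (subT ⬝ num 1 ⬝ (badT.closed ⬝ v2 ⬝ v1 ⬝ v0 ⬝ (searchT.closed ⬝ v2 ⬝ v1 ⬝ v0))) .zero)))

/-! ### Recursion equations and correctness of the search in a model -/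

namespace Model

variable {M : Model}

abbrev rem (k s : M.D .nat) : M.D .nat := M.app (M.app (remT.eval (Env.nil _)) k) s
abbrev quo (k s : M.D .nat) : M.D .nat := M.app (M.app (quoT.eval (Env.nil _)) k) s
abbrev mul (k q : M.D .nat) : M.D .nat := M.app (M.app (mulT.eval (Env.nil _)) k) q
abbrev pow (k n : M.D .nat) : M.D .nat := M.app (M.app (powT.eval (Env.nil _)) k) n
abbrev shift (k s j : M.D .nat) : M.D .nat :=
  M.app (M.app (M.app (shiftT.eval (Env.nil _)) k) s) j
abbrev enc (k : M.D .nat) (f : M.D .one) (n : M.D .nat) : M.D .nat :=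
  M.app (M.app (M.app (encT.eval (Env.nil _)) k) f) n
abbrev dig (k s m : M.D .nat) : M.D .one :=
  M.app (M.app (M.app (digT.eval (Env.nil _)) k) s) m
abbrev bad (k : M.D .nat) (G : M.D .one) (m : M.D .nat) : M.D .one :=
  M.app (M.app (M.app (badT.eval (Env.nil _)) k) G) m
abbrev find (p : M.D .one) (n : M.D .nat) : M.D .nat :=
  M.app (M.app (findT.eval (Env.nil _)) p) n
abbrev search (k : M.D .nat) (G : M.D .one) (m : M.D .nat) : M.D .nat :=
  M.app (M.app (M.app (searchT.eval (Env.nil _)) k) G) m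
abbrev col (k : M.D .nat) (G : M.D .one) (m : M.D .nat) : M.D .nat :=
  M.app (M.app (M.app (colT.eval (Env.nil _)) k) G) m

theorem rem_zero (k : M.D .nat) : rem k 0 = 0 := by
  simp only [rem, remT, eval_lam]
  exact eval_precT_zero _ _ _

/-- Remainder and quotient are counted up together: `k - (rem k s + 1)` is zero once the remainder
would reach `k`, which then resets it and advances the quotient. -/
theorem rem_add_one (k s : M.D .nat) :
    rem k (s + 1) = cond (k - (rem k s + 1)) (rem k s + 1) 0 := by
  simp only [rem, remT, eval_lam]
  rw [eval_precT_add_one, eval_condT, eval_subT, eval_succ]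
  rfl

theorem quo_zero (k : M.D .nat) : quo k 0 = 0 := by
  simp only [quo, quoT, eval_lam]
  exact eval_precT_zero _ _ _

theorem quo_add_one (k s : M.D .nat) :
    quo k (s + 1) = cond (k - (rem k s + 1)) (quo k s) (quo k s + 1) := by
  simp only [quo, quoT, eval_lam]
  rw [eval_precT_add_one, eval_condT, eval_subT, eval_succ, eval_succ, eval_app, eval_app,
    Tm.eval_closed]
  rfl

theorem mul_zero (k : M.D .nat) : mul k 0 = 0 := by
  simp only [mul, mulT, eval_lam]
  exact eval_precT_zero _ _ _

theorem mul_add_one (k q : M.D .nat) : mul k (q + 1) = mul k q + k := by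
  simp only [mul, mulT, eval_lam]
  rw [eval_precT_add_one, eval_addT]
  rfl

theorem pow_zero (k : M.D .nat) : pow k 0 = 1 := by
  simp only [pow, powT, eval_lam]
  exact eval_precT_zero _ _ _

theorem pow_add_one (k n : M.D .nat) : pow k (n + 1) = mul k (pow k n) := by
  simp only [pow, powT, eval_lam]
  rw [eval_precT_add_one, eval_app, eval_app, Tm.eval_closed]
  rfl

theorem shift_zero (k s : M.D .nat) : shift k s 0 = s := by
  simp only [shift, shiftT, eval_lam]
  exact eval_precT_zero _ _ _

theorem shift_add_one (k s j : M.D .nat) : shift k s (j + 1) = quo k (shift k s j) := by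
  simp only [shift, shiftT, eval_lam]
  rw [eval_precT_add_one, eval_app, eval_app, Tm.eval_closed]
  rfl

theorem enc_zero (k : M.D .nat) (f : M.D .one) : enc k f 0 = 0 := by
  simp only [enc, encT, eval_lam]
  exact eval_precT_zero _ _ _

theorem enc_add_one (k : M.D .nat) (f : M.D .one) (n : M.D .nat) :
    enc k f (n + 1) = mul k (enc k f n) + M.app f n := by
  simp only [enc, encT, eval_lam]
  rw [eval_precT_add_one, eval_addT, eval_app, eval_app, Tm.eval_closed]
  rfl

theorem dig_eq (k s m a : M.D .nat) : M.app (dig k s m) a = rem k (shift k s (m - a)) := by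
  simp only [dig, digT, eval_lam]
  rw [eval_app, eval_app, eval_app, eval_app, eval_app, Tm.eval_closed, Tm.eval_closed, eval_subT]
  rfl

theorem find_add_one (p : M.D .one) (n : M.D .nat) :
    find p (n + 1) = cond (M.app p n) (find p n) n := by
  simp only [find, findT, eval_lam]
  rw [eval_precT_add_one, eval_condT]
  rfl

theorem search_eq (k : M.D .nat) (G : M.D .one) (m : M.D .nat) :
    search k G m = find (bad k G m) (pow k (m + 1)) := by
  simp only [search, searchT, eval_lam]
  simp only [Tm.eval_closed, succ_eq, Tm.eval]
  rfl

theorem col_eq (k : M.D .nat) (G : M.D .one) (m : M.D .nat) :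
    col k G m = cond k (1 - M.app (bad k G m) (search k G m)) 0 := by
  simp only [col, colT, eval_lam]
  rw [eval_condT, eval_subT]
  simp only [Tm.eval_closed, Tm.eval]
  rfl

theorem eval_eqT_ne_zero_iff {Γ : Ctx} (e : Env M.toInterp Γ) (s t : Tm Γ .nat) :
    (eqT s t).eval e ≠ 0 ↔ s.eval e = t.eval e := by
  rw [eqT, eval_subT, eval_addT, eval_subT, eval_subT]
  refine one_sub_ne_zero_iff.trans ?_
  rw [add_eq_zero]
  exact ⟨fun h => le_antisymm h.1 h.2, fun h => by rw [h]; simp⟩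

theorem bad_eq_zero_iff (k : M.D .nat) (G : M.D .one) (m s : M.D .nat) :
    M.app (bad k G m) s = 0 ↔ ∀ b ≤ m, ∀ a < b, M.app G (pairCode a b) ≠ 0 →
      M.app (dig k s m) a ≠ M.app (dig k s m) b := by
  simp only [bad, badT, eval_lam]
  rw [eval_app, eval_app, Tm.eval_closed, eval_succ]
  refine bsum_eq_zero_iff.trans (forall_congr' fun b => ?_)
  rw [eval_lam, eval_app, eval_app, Tm.eval_closed]
  refine imp_congr lt_add_one_iff (bsum_eq_zero_iff.trans (forall_congr' fun a =>
    imp_congr Iff.rfl ?_))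
  rw [eval_lam, eval_condT, eval_app, eval_codeT]
  have hd : ∀ (e : Env M.toInterp _) (x y z w), (digT.closed ⬝ x ⬝ y ⬝ z ⬝ w :
      Tm [.nat, .nat, .nat, .nat, .one, .nat] .nat).eval e =
      M.app (dig (x.eval e) (y.eval e) (z.eval e)) (w.eval e) := by
    intro e x y z w
    simp only [eval_app, Tm.eval_closed]
  have heq := eval_eqT_ne_zero_iff (M := M)
    (Env.cons a (Env.cons b (Env.cons s (Env.cons m (Env.cons G (Env.cons k (Env.nil _)))))))
    (digT.closed ⬝ .var (.s (.s (.s (.s (.s .z))))) ⬝ v2 ⬝ v3 ⬝ v0)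
    (digT.closed ⬝ .var (.s (.s (.s (.s (.s .z))))) ⬝ v2 ⬝ v3 ⬝ v1)
  rw [hd, hd] at heq
  change cond (M.app G (pairCode a b)) _ 0 = 0 ↔ _
  by_cases hG : M.app G (pairCode a b) = 0
  · rw [hG, cond_zero]
    exact iff_of_true rfl fun h => (h rfl).elim
  · rw [cond_of_ne hG]
    exact (not_ne_iff.symm.trans (not_congr heq)).trans ⟨fun h _ => h, fun h => h hG⟩

theorem rem_lt {k : M.D .nat} (hk : 0 < k) (s : M.D .nat) : rem k s < k := by
  induction s using induct with
  | hP => infer_instance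
  | h0 => rwa [rem_zero]
  | hs s ih =>
    rw [rem_add_one]
    by_cases h : k - (rem k s + 1) = 0
    · rwa [h, cond_zero]
    · rw [cond_of_ne h]
      rwa [sub_eq_zero_iff, not_le] at h

theorem rem_quo_add {k s r : M.D .nat} (hs : rem k s = 0) (hr : r < k) :
    rem k (s + r) = r ∧ quo k (s + r) = quo k s := by
  revert hr
  induction r using induct with
  | hP => infer_instance
  | h0 => exact fun _ => ⟨by rw [add_zero, hs], by rw [add_zero]⟩
  | hs r ih =>
    intro hr
    obtain ⟨h1, h2⟩ := ih ((le_of_lt (lt_add_one_iff.mpr le_rfl)).trans_lt hr)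
    have h : k - (r + 1) ≠ 0 := by rwa [Ne, sub_eq_zero_iff, not_le]
    rw [← add_assoc, rem_add_one, quo_add_one, h1, h2, cond_of_ne h, cond_of_ne h]
    exact ⟨rfl, rfl⟩

theorem rem_quo_mul {k : M.D .nat} (hk : 0 < k) (q : M.D .nat) :
    rem k (mul k q) = 0 ∧ quo k (mul k q) = q := by
  -- With `k = j + 1`, adding `k` consists of `j` steps without a reset, covered by `rem_quo_add`,
  -- and one step with a reset.
  obtain ⟨j, rfl⟩ := (eq_zero_or_eq_add_one k).resolve_left hk.ne'
  induction q using induct with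
  | hP => infer_instance
  | h0 => rw [mul_zero]; exact ⟨rem_zero _, quo_zero _⟩
  | hs q ih =>
    obtain ⟨h1, h2⟩ := rem_quo_add ih.1 (lt_add_one_iff.mpr (le_refl j))
    rw [mul_add_one, ← add_assoc, rem_add_one, quo_add_one, h1, h2, tsub_self, cond_zero,
      cond_zero, ih.2]
    exact ⟨rfl, rfl⟩

theorem rem_mul_add {k q r : M.D .nat} (hr : r < k) : rem k (mul k q + r) = r :=
  (rem_quo_add (rem_quo_mul (pos_of_gt hr) q).1 hr).1

theorem quo_mul_add {k q r : M.D .nat} (hr : r < k) : quo k (mul k q + r) = q := by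
  have h := rem_quo_mul (pos_of_gt hr) q
  exact (rem_quo_add h.1 hr).2.trans h.2

theorem mul_mono (k : M.D .nat) {x y : M.D .nat} (h : x ≤ y) : mul k x ≤ mul k y := by
  obtain ⟨z, rfl⟩ := exists_add_of_le h
  induction z using induct with
  | hP => infer_instance
  | h0 => rw [add_zero]
  | hs z ih =>
    rw [← add_assoc, mul_add_one]
    exact (ih le_self_add).trans le_self_add

/-! ### Digits in base `k` -/

section Digits

variable {k m : M.D .nat} {f : M.D .one}

/-- Appending a digit below `k` to `e` gives a number below `k (e + 1)`, and `e + 1 ≤ k ^ n` by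
induction. -/
theorem enc_lt_pow (hf : ∀ a ≤ m, M.app f a < k) : enc k f (m + 1) < pow k (m + 1) := by
  have key (n : M.D .nat) : n ≤ m + 1 → enc k f n < pow k n := by
    induction n using induct with
    | hP => infer_instance
    | h0 => rw [enc_zero, pow_zero]; exact fun _ => zero_lt_one'
    | hs n ih =>
      intro hn
      have hn : n < m + 1 := hn
      rw [enc_add_one, pow_add_one]
      refine (add_lt_add_right (hf n (lt_add_one_iff.mp hn)) _).trans_le ?_
      rw [← mul_add_one]
      exact mul_mono k (ih hn.le)
  exact key _ le_rfl

theorem shift_enc (hf : ∀ a ≤ m, M.app f a < k) {j : M.D .nat} (hj : j ≤ m + 1) :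
    shift k (enc k f (m + 1)) j = enc k f (m + 1 - j) := by
  revert hj
  induction j using induct with
  | hP => infer_instance
  | h0 => rw [shift_zero, tsub_zero]; exact fun _ => rfl
  | hs j ih =>
    intro hj
    have hj : j < m + 1 := hj
    have h : m + 1 - j = m + 1 - (j + 1) + 1 := by
      rw [← tsub_tsub, tsub_add_cancel_of_le]
      rw [le_tsub_iff_left hj.le]
      exact hj
    rw [shift_add_one, ih hj.le, h, enc_add_one, quo_mul_add]
    refine hf _ (lt_add_one_iff.mp ?_)
    rw [lt_def, ← h]
    exact tsub_le_self

/-- The digit `f 0` is the leading one. Removing the last `m - a` of the `m + 1` digits leaves `f 0,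
…, f a`, whose last digit is the remainder. -/
theorem dig_enc (hf : ∀ a ≤ m, M.app f a < k) {a : M.D .nat} (ha : a ≤ m) :
    M.app (dig k (enc k f (m + 1)) m) a = M.app f a := by
  have h : m + 1 - (m - a) = a + 1 := by
    rw [tsub_eq_iff_eq_add_of_le (tsub_le_self.trans le_self_add), add_right_comm,
      add_tsub_cancel_of_le ha]
  rw [dig_eq, shift_enc hf (tsub_le_self.trans le_self_add), h, enc_add_one,
    rem_mul_add (hf a ha)]

end Digits

theorem find_spec {p : M.D .one} {n i : M.D .nat} (hi : i < n) (hp : M.app p i = 0) :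
    M.app p (find p n) = 0 := by
  revert hi
  induction n using induct with
  | hP => infer_instance
  | h0 => exact fun h => (not_lt_zero h).elim
  | hs n ih =>
    intro hi
    rw [find_add_one]
    by_cases h : M.app p n = 0
    · rw [h, cond_zero, h]
    · rw [cond_of_ne h]
      refine ih ((lt_add_one_iff.mp hi).lt_of_ne ?_)
      rintro rfl
      exact h hp

/-- `colT` tests the outcome of the search again, so the default result of a failed search does no
harm. The separate case `k = 0` is needed because digits are below `k` only for positive `k`. -/
theorem isColoring_of_col_ne_zero {k m : M.D .nat} {G : M.D .one} (h : col k G m ≠ 0) :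
    IsColoring k G m (dig k (search k G m) m) ∧ col k G m = 1 := by
  rw [col_eq] at h ⊢
  have hk : k ≠ 0 := by
    rintro rfl
    exact h (cond_zero _ _)
  rw [cond_of_ne hk] at h ⊢
  rw [one_sub_ne_zero_iff] at h
  refine ⟨⟨fun a _ => ?_, fun a b hab hb => (bad_eq_zero_iff _ _ _ _).mp h b hb a hab⟩, ?_⟩
  · rw [dig_eq]
    exact rem_lt (pos_iff_ne_zero.mpr hk) _
  · rw [h, tsub_zero]

/-- The code of `f` lies below the bound of the search and has the values of `f` as digits, so the
search finds some number without bad edges. -/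
theorem col_ne_zero {k m : M.D .nat} {G f : M.D .one} (hf : IsColoring k G m f) :
    col k G m ≠ 0 := by
  have hk : k ≠ 0 := (pos_of_gt (hf.1 m le_rfl)).ne'
  rw [col_eq, cond_of_ne hk, one_sub_ne_zero_iff, search_eq]
  refine find_spec (enc_lt_pow hf.1) ((bad_eq_zero_iff _ _ _ _).mpr fun b hb a hab hG => ?_)
  rw [dig_enc hf.1 hb, dig_enc hf.1 (hab.le.trans hb)]
  exact hf.2 a b hab hb hG

end Model

open Model in
-- The disjunction comes from deciding in the system whether the value of `colT` is `0`, and the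
-- existential quantifier from the digits of the number found. What remains is negative and is
-- checked in models.
theorem provable_decidesColorable : Provable (decidesColorable colT) := by
  refine .allI (.allI (.allI (.orE (.eq_zero_or_ne (colT.closed ⬝ v2 ⬝ v1 ⬝ v0))
    (.orI₂ (.andI (.impI ?_) .head)) (.orI₁ (.andI ?_ ?_)))))
  · rw [colorable_eq]
    refine .exE .head (complete (A := .bot) trivial fun M e hH => ?_)
    obtain ⟨f, e, rfl⟩ : ∃ f e', e = Env.cons f e' :=
      ⟨e _ .z, fun _ x => e _ x.s, Env.ext_cons rfl fun _ _ => rfl⟩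
    have hf := (eval_coloringFm _ _ _ _ _).mp (hH _ List.mem_cons_self (coloringFm_neg _ _ _))
    have h0 := (Fm.eval_wk _ _ _).mp
      (hH (Fm.wk (colT.closed ⬝ v2 ⬝ v1 ⬝ v0 ≐ .zero)) (by simp) trivial)
    rw [Fm.eval, eval_app, eval_app, eval_app, Tm.eval_closed] at h0
    exact col_ne_zero hf h0
  · rw [colorable_eq]
    refine .exI (digT.closed ⬝ v2 ⬝ (searchT.closed ⬝ v2 ⬝ v1 ⬝ v0) ⬝ v0)
      (complete ((coloringFm_neg _ _ _).subst _) fun M e hH => ?_)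
    have h0 := hH _ List.mem_cons_self (by simp [Fm.neg, Fm.Neg])
    rw [Fm.neg, Fm.eval, Fm.eval, eval_app, eval_app, eval_app, Tm.eval_closed] at h0
    rw [Fm.eval_inst, eval_coloringFm]
    simp only [eval_app, Tm.eval_closed]
    exact (isColoring_of_col_ne_zero h0).1
  · refine complete trivial fun M e hH => ?_
    have h0 := hH _ List.mem_cons_self (by simp [Fm.neg, Fm.Neg])
    rw [Fm.neg, Fm.eval, Fm.eval, eval_app, eval_app, eval_app, Tm.eval_closed] at h0
    rw [Fm.eval, eval_app, eval_app, eval_app, Tm.eval_closed]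
    exact (isColoring_of_col_ne_zero h0).2

end IRCA

theorem mainTheorem2 :
    (∃ c : IRCA.Tm [] IRCA.Ty.col, IRCA.Provable (IRCA.decidesColorable c)) ∧
    ∀ c : IRCA.Tm [] IRCA.Ty.col, IRCA.Provable (IRCA.decidesColorable c) →
      IRCA.Provable (IRCA.localColoringSentence c) ∧
      IRCA.Provable ((IRCA.LG c (IRCA.num 2)).equiv (IRCA.LG c (IRCA.num 3))) :=
  ⟨⟨IRCA.colT, IRCA.provable_decidesColorable⟩, fun _ hc =>
    ⟨IRCA.provable_localColoringSentence hc,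
      IRCA.LG_equiv_LG hc (IRCA.one_le_num_add_one 1) (IRCA.one_le_num_add_one 2)⟩⟩
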